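/- All point sets are finite subsets of the Euclidean plane. A point set is in general position if no three of its points are collinear. An edge of a point set $P$ is a line segment with two distinct endpoints in $P$, and a triangulation of $P$ is an inclusion-maximal set of edges of $P$ any two of which are disjoint except possibly for a common endpoint. Write $\operatorname{CH}(P)$ for the set of vertices of the convex hull of $P$. For point sets $P, Q$, a bijection $f_0\colon \operatorname{CH}(P)\to\operatorname{CH}(Q)$ is called cyclic if for all $p,p'\in \operatorname{CH}(P)$, the segment $pp'$ is an edge of the convex hull of $P$ if and only if $f_0(p)f_0(p')$ is an edge of the convex hull of $Q$. Two point sets $P,Q$ have the same order type if there is a bijection $g\colon P\to Q$ such that for all $p,q,r \in P$ the triple $(p,q,r)$ is in counterclockwise order if and only if $(g(p),g(q),g(r))$ is. A point set $P$ is called universal if for every point set $Q$ in general position with $|P|=|Q|$ and every cyclic bijection $f_0\colon \operatorname{CH}(P)\to\operatorname{CH}(Q)$ there are a bijection $f\colon P\to Q$ extending $f_0$, a triangulation $T_P$ of $P$ and a triangulation $T_Q$ of $Q$ such that for all $p,p'\in P$, the edge $pp'$ is in $T_P$ if and only if $f(p)f(p')$ is in $T_Q$. Let $n\ge 3$, let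 $P_1P_2\cdots P_n$ be a regular polygon with center $O$ (indices modulo $n$), and for $\varepsilon>0$ not exceeding the distance from $O$ to the sides let $A_i(\varepsilon)$ be the point on the segment connecting $O$ and the midpoint of $P_iP_{i+1}$ that has distance $\varepsilon$ to $P_iP_{i+1}$. A double circle is a point set $\{P_1,\dots,P_n,A_1(\varepsilon),\dots,A_n(\varepsilon)\}$ where $\varepsilon>0$ is so small that for every $0<\varepsilon'<\varepsilon$ the set $\{P_1,\dots,P_n,A_1(\varepsilon'),\dots,A_n(\varepsilon')\}$ has the same order type. **Theorem.** Every double circle is universal. -/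

import Mathlib

/-! The Euclidean plane is `ℂ` (with its real structure); a point set is a `Finset ℂ`. -/

noncomputable section

namespace DoubleCircle

/-- No three distinct points of `P` are collinear. -/
def GeneralPosition (P : Finset ℂ) : Prop :=
  ∀ p ∈ P, ∀ q ∈ P, ∀ r ∈ P, p ≠ q → p ≠ r → q ≠ r → ¬ Collinear ℝ {p, q, r}

/-- The triple `(p, q, r)` is in counterclockwise order: `det (q - p, r - p) > 0`. -/
def CCW (p q r : ℂ) : Prop :=
  0 < (q.re - p.re) * (r.im - p.im) - (q.im - p.im) * (r.re - p.re)

/-- Two point sets have the same order type. -/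
def SameOrderType (P Q : Finset ℂ) : Prop :=
  ∃ f : ℂ → ℂ, Set.BijOn f P Q ∧
    ∀ p ∈ P, ∀ q ∈ P, ∀ r ∈ P, CCW p q r ↔ CCW (f p) (f q) (f r)

/-- The vertices of the convex hull of `P`. -/
def hullVertices (P : Finset ℂ) : Set ℂ :=
  (convexHull ℝ (P : Set ℂ)).extremePoints ℝ

/-- The segment from `p` to `q` is an edge of the convex hull of `P`. -/
def IsHullEdge (P : Finset ℂ) (p q : ℂ) : Prop :=
  p ∈ hullVertices P ∧ q ∈ hullVertices P ∧ p ≠ q ∧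
    segment ℝ p q ⊆ frontier (convexHull ℝ (P : Set ℂ))

/-- A cyclic mapping from the hull vertices of `P` to the hull vertices of `Q`:
a bijection that preserves and reflects hull edges. -/
def IsCyclicMap (P Q : Finset ℂ) (f₀ : ℂ → ℂ) : Prop :=
  Set.BijOn f₀ (hullVertices P) (hullVertices Q) ∧
    ∀ p ∈ hullVertices P, ∀ q ∈ hullVertices P,
      IsHullEdge P p q ↔ IsHullEdge Q (f₀ p) (f₀ q)

/-- The edges of `P`, as unordered pairs of distinct points of `P`. -/
def edges (P : Finset ℂ) : Set (Sym2 ℂ) :=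
  {e | ¬ e.IsDiag ∧ ∀ x ∈ e, x ∈ P}

/-- The line segment spanned by an unordered pair of points. -/
def edgeSegment (e : Sym2 ℂ) : Set ℂ :=
  convexHull ℝ {x | x ∈ e}

/-- A set of edges of `P` in which two different edges never meet, except in a common endpoint. -/
def IsNonCrossing (P : Finset ℂ) (T : Set (Sym2 ℂ)) : Prop :=
  T ⊆ edges P ∧ ∀ e ∈ T, ∀ e' ∈ T, e ≠ e' →
    ∀ x ∈ edgeSegment e ∩ edgeSegment e', x ∈ e ∧ x ∈ e'

/-- A triangulation of `P`: an inclusion-maximal set of non-intersecting edges of `P`. -/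
def IsTriangulation (P : Finset ℂ) (T : Set (Sym2 ℂ)) : Prop :=
  Maximal (IsNonCrossing P) T

/-- `(TP, TQ)` is a compatible triangulation of `(P, Q)` with respect to `f`. -/
def IsCompatibleTriangulation (P Q : Finset ℂ) (f : ℂ → ℂ) (TP TQ : Set (Sym2 ℂ)) : Prop :=
  IsTriangulation P TP ∧ IsTriangulation Q TQ ∧
    ∀ p ∈ P, ∀ q ∈ P, s(p, q) ∈ TP ↔ s(f p, f q) ∈ TQ

/-- `P` is universal: for every point set `Q` in general position with as many points as `P`,
every cyclic mapping of the hull vertices extends to a bijection `P → Q` with respect to which a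
compatible triangulation exists. -/
def IsUniversal (P : Finset ℂ) : Prop :=
  ∀ Q : Finset ℂ, GeneralPosition Q → P.card = Q.card →
    ∀ f₀ : ℂ → ℂ, IsCyclicMap P Q f₀ →
      ∃ f : ℂ → ℂ, Set.BijOn f P Q ∧ Set.EqOn f f₀ (hullVertices P) ∧
        ∃ TP TQ : Set (Sym2 ℂ), IsCompatibleTriangulation P Q f TP TQ

/-- The `k`-th vertex of the regular `n`-gon with center `c` and zeroth vertex `c + w`
(`n`-periodic in `k`). -/
def vertex (n : ℕ) (c w : ℂ) (k : ℕ) : ℂ :=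
  c + w * Complex.exp (2 * Real.pi * Complex.I * (k / n))

/-- The midpoint of the `k`-th side of the regular polygon. -/
def sideMidpoint (n : ℕ) (c w : ℂ) (k : ℕ) : ℂ :=
  midpoint ℝ (vertex n c w k) (vertex n c w (k + 1))

/-- The point on the segment from the midpoint of the `k`-th side to the center `c`, at distance
`ε` from that midpoint, hence (the segment being perpendicular to the side) from the side. -/
def innerPoint (n : ℕ) (c w : ℂ) (ε : ℝ) (k : ℕ) : ℂ :=
  AffineMap.lineMap (sideMidpoint n c w k) c (ε / dist (sideMidpoint n c w k) c)

/-- The vertices of the regular polygon together with the `n` inner points at offset `ε`. -/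
def offsetPolygon (n : ℕ) (c w : ℂ) (ε : ℝ) : Finset ℂ :=
  (Finset.range n).image (vertex n c w) ∪ (Finset.range n).image (innerPoint n c w ε)

/-- `P` is a double circle: the vertices of a regular `n`-gon, `n ≥ 3`, together with the inner
points at an offset `ε > 0` so small that no smaller offset gives another order type. -/
def IsDoubleCircle (P : Finset ℂ) : Prop :=
  ∃ (n : ℕ) (c w : ℂ) (ε : ℝ), 3 ≤ n ∧ w ≠ 0 ∧ 0 < ε ∧
    (∀ k < n, ε ≤ dist (sideMidpoint n c w k) c) ∧
    (∀ ε' : ℝ, 0 < ε' → ε' < ε →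
      SameOrderType (offsetPolygon n c w ε) (offsetPolygon n c w ε')) ∧
    P = offsetPolygon n c w ε

end DoubleCircle

end

/-!
Label a double circle `P` along the polygon `P₁ A₁ P₂ A₂ … Pₙ Aₙ` through all its points. The only
triples of labels that are not counterclockwise are the triples `Pᵢ, Aᵢ, Pᵢ₊₁`, so a combinatorial
triangulation of this `2 n`-gon is realised by `P` as soon as it avoids these `n` triangles. Hence it
suffices to assign the `n` inner points of `Q` to the sides of its convex hull such that the polygon
`Q₁ B₁ Q₂ B₂ … Qₙ Bₙ` has a triangulation with positively oriented triangles. Completed by the pockets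
`Qᵢ Bᵢ Qᵢ₊₁`, the same combinatorial triangulation then gives a triangulation of `P` and one of `Q`.

*The assignment* (`exists_perm_swap_le`, `pocket_separation`). Let `ℓᵢ` be the distance from the line
of the `i`-th side, up to a factor. Choose the assignment that minimises `∏ ℓᵢ(Bᵢ)`. As the
exchange of `Bᵢ` and `Bⱼ` does not decrease the product, a line through the intersection of the
lines of the sides `i` and `j` (or parallel to both, if they are parallel) separates the pockets at
these two sides.

*The triangulation* (`exists_chainTri_of_matching`). Move the inner points of `Q` along segments from
the midpoints of the sides to their final positions. At the start the triangles at one of the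
midpoints are positively oriented. The set of times at which some triangulation has no negatively
oriented triangle is closed. At such a time strictly between the start and the end the polygon is
simple, since the growing pockets stay separated, and then flips of longest edges of degenerate
triangles lead to a positively oriented triangulation (`exists_chainTri_pos`), which remains
positive for a while. So the final polygon has a triangulation without negatively oriented triangles,
and general position excludes degenerate ones.

*From orientations to geometry* (`PosTri.isTriangulation`). In the sum over all triangles of the
signed crossings of their boundaries with a ray from a point `x`, the inner edges cancel, and the
sides of the convex hull contribute at most one crossing, and exactly one if `x` is in the interior of
the hull. So the triangles have disjoint interiors and cover the hull, which shows that their edges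
do not cross and that no edge can be added.
-/

noncomputable section

namespace DoubleCircle

/-! ### Triangulations of a polygon as binary trees -/

/-- `ChainTri a c S`: the multiset `S` of index triples is the set of triangles of a combinatorial
triangulation of the polygon with vertices `a, a + 1, …, c`. The triangle on the closing edge
`(a, c)` has an apex `b`, and cuts the polygon into the polygons on `a, …, b` and on `b, …, c`.
Every triple `(x, y, z)` in `S` has `x < y < z`. -/
inductive ChainTri : ℕ → ℕ → Multiset (ℕ × ℕ × ℕ) → Prop
  | edge (a : ℕ) : ChainTri a (a + 1) 0
  | node {a b c : ℕ} {L R : Multiset (ℕ × ℕ × ℕ)} (hL : ChainTri a b L) (hR : ChainTri b c R) :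
      ChainTri a c ((a, b, c) ::ₘ (L + R))

/-- `(x, y)` is one of the three edges of `t`, directed along the cyclic order of `t`. -/
def HasEdge (t : ℕ × ℕ × ℕ) (x y : ℕ) : Prop :=
  (x = t.1 ∧ y = t.2.1) ∨ (x = t.2.1 ∧ y = t.2.2) ∨ (x = t.2.2 ∧ y = t.1)

/-- `t` is a cyclic rotation of `(x, y, z)`. -/
def IsRot (t : ℕ × ℕ × ℕ) (x y z : ℕ) : Prop :=
  t = (x, y, z) ∨ t = (y, z, x) ∨ t = (z, x, y)

theorem HasEdge.exists_isRot {t : ℕ × ℕ × ℕ} {x y : ℕ} (h : HasEdge t x y) :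
    ∃ z, IsRot t x y z := by
  obtain ⟨a, b, c⟩ := t
  rcases h with ⟨rfl, rfl⟩ | ⟨rfl, rfl⟩ | ⟨rfl, rfl⟩
  · exact ⟨c, Or.inl rfl⟩
  · exact ⟨a, Or.inr (Or.inr rfl)⟩
  · exact ⟨b, Or.inr (Or.inl rfl)⟩

namespace ChainTri

variable {a c : ℕ} {S : Multiset (ℕ × ℕ × ℕ)}

theorem lt (h : ChainTri a c S) : a < c := by
  induction h with
  | edge a => omega
  | node _ _ h1 h2 => omega

theorem bounds (h : ChainTri a c S) :
    ∀ x y z, (x, y, z) ∈ S → a ≤ x ∧ x < y ∧ y < z ∧ z ≤ c := by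
  induction h with
  | edge a => simp
  | node hL hR h1 h2 =>
    intro x y z ht
    have := hL.lt
    have := hR.lt
    simp only [Multiset.mem_cons, Multiset.mem_add, Prod.mk.injEq] at ht
    rcases ht with ht | ht | ht
    · omega
    · have := h1 x y z ht
      omega
    · have := h2 x y z ht
      omega

theorem finite (a c : ℕ) : {S | ChainTri a c S}.Finite := by
  induction hd : c - a using Nat.strong_induction_on generalizing a c with
  | _ d ih =>
    subst hd
    have hf : ((⋃ b ∈ Set.Ioo a c, Set.image2 (fun L R => (a, b, c) ::ₘ (L + R))
        {S | ChainTri a b S} {S | ChainTri b c S}) : Set (Multiset (ℕ × ℕ × ℕ))).Finite := by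
      refine (Set.finite_Ioo a c).biUnion fun b hb => Set.Finite.image2 _ ?_ ?_
      · exact ih (b - a) (by have := hb.1; have := hb.2; omega) a b rfl
      · exact ih (c - b) (by have := hb.1; have := hb.2; omega) b c rfl
    refine ((Set.finite_singleton 0).union hf).subset ?_
    intro S hS
    cases hS with
    | edge => exact Or.inl rfl
    | @node _ b _ L R hL hR =>
      right
      simp only [Set.mem_iUnion]
      exact ⟨b, ⟨hL.lt, hR.lt⟩, L, hL, R, hR, rfl⟩

/-- The triangles incident to a fixed vertex of the polygon form a triangulation. -/
theorem fan (a d : ℕ) :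
    ∃ S, ChainTri a (a + 1 + d) S ∧ ∀ t ∈ S, ∃ k, a < k ∧ k < a + 1 + d ∧ t = (a, k, k + 1) := by
  induction d with
  | zero => exact ⟨0, .edge a, by simp⟩
  | succ d ih =>
    obtain ⟨S, hS, h⟩ := ih
    refine ⟨_, .node hS (.edge _), ?_⟩
    intro t ht
    simp only [add_zero, Multiset.mem_cons] at ht
    rcases ht with rfl | ht
    · exact ⟨a + 1 + d, by omega, by omega, rfl⟩
    · obtain ⟨k, h1, h2, h3⟩ := h t ht
      exact ⟨k, h1, by omega, h3⟩

theorem eq_node_of_mem {b : ℕ} (h : ChainTri a c S) (hb : (a, b, c) ∈ S) :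
    ∃ L R, ChainTri a b L ∧ ChainTri b c R ∧ S = (a, b, c) ::ₘ (L + R) := by
  cases h with
  | edge => simp at hb
  | @node _ b' _ L R hL hR =>
    simp only [Multiset.mem_cons, Multiset.mem_add, Prod.mk.injEq] at hb
    have h1 := hL.lt
    have h2 := hR.lt
    rcases hb with hb | hb | hb
    · obtain ⟨_, rfl, _⟩ := hb
      exact ⟨L, R, hL, hR, rfl⟩
    · have := hL.bounds _ _ _ hb
      omega
    · have := hR.bounds _ _ _ hb
      omega

/-- Flip of the diagonal `(i, k)` of the quadrilateral `i < j < k < l` to `(j, l)`. -/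
theorem flip_up {i j k l : ℕ} (h : ChainTri a c S) (h1 : (i, j, k) ∈ S) (h2 : (i, k, l) ∈ S) :
    ∃ U, S = (i, j, k) ::ₘ (i, k, l) ::ₘ U ∧ ChainTri a c ((i, j, l) ::ₘ (j, k, l) ::ₘ U) := by
  induction h with
  | edge => simp at h1
  | @node a b c L R hL hR ihL ihR =>
    have b1 := (ChainTri.node hL hR).bounds _ _ _ h1
    have b2 := (ChainTri.node hL hR).bounds _ _ _ h2
    simp only [Multiset.mem_cons, Multiset.mem_add, Prod.mk.injEq] at h1 h2
    rcases h2 with ⟨rfl, rfl, rfl⟩ | h2 | h2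
    · have h1 : (i, j, k) ∈ L := by
        rcases h1 with h1 | h1 | h1
        · omega
        · exact h1
        · have := hR.bounds _ _ _ h1
          omega
      obtain ⟨L1, L2, hL1, hL2, rfl⟩ := hL.eq_node_of_mem h1
      refine ⟨L1 + L2 + R, ?_, ?_⟩
      · rw [Multiset.cons_add, Multiset.cons_swap]
      · convert ChainTri.node hL1 (ChainTri.node hL2 hR) using 1
        rw [Multiset.add_cons, add_assoc]
    · have bL := hL.bounds _ _ _ h2
      have h1 : (i, j, k) ∈ L := by
        rcases h1 with h1 | h1 | h1
        · omega
        · exact h1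
        · have := hR.bounds _ _ _ h1
          omega
      obtain ⟨U, rfl, hU⟩ := ihL h1 h2
      refine ⟨(a, b, c) ::ₘ (U + R), ?_, ?_⟩
      · simp only [← Multiset.singleton_add]
        abel
      · convert ChainTri.node hU hR using 1
        simp only [← Multiset.singleton_add]
        abel
    · have bR := hR.bounds _ _ _ h2
      have h1 : (i, j, k) ∈ R := by
        rcases h1 with h1 | h1 | h1
        · omega
        · have := hL.bounds _ _ _ h1
          omega
        · exact h1
      obtain ⟨U, rfl, hU⟩ := ihR h1 h2
      refine ⟨(a, b, c) ::ₘ (L + U), ?_, ?_⟩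
      · simp only [← Multiset.singleton_add]
        abel
      · convert ChainTri.node hL hU using 1
        simp only [← Multiset.singleton_add]
        abel

/-- Flip of the diagonal `(j, l)` of the quadrilateral `i < j < k < l` to `(i, k)`. -/
theorem flip_down {i j k l : ℕ} (h : ChainTri a c S) (h1 : (i, j, l) ∈ S) (h2 : (j, k, l) ∈ S) :
    ∃ U, S = (i, j, l) ::ₘ (j, k, l) ::ₘ U ∧ ChainTri a c ((i, j, k) ::ₘ (i, k, l) ::ₘ U) := by
  induction h with
  | edge => simp at h1
  | @node a b c L R hL hR ihL ihR =>
    have b1 := (ChainTri.node hL hR).bounds _ _ _ h1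
    have b2 := (ChainTri.node hL hR).bounds _ _ _ h2
    simp only [Multiset.mem_cons, Multiset.mem_add, Prod.mk.injEq] at h1 h2
    rcases h1 with ⟨rfl, rfl, rfl⟩ | h1 | h1
    · have h2 : (j, k, l) ∈ R := by
        rcases h2 with h2 | h2 | h2
        · omega
        · have := hL.bounds _ _ _ h2
          omega
        · exact h2
      obtain ⟨R1, R2, hR1, hR2, rfl⟩ := hR.eq_node_of_mem h2
      refine ⟨L + R1 + R2, ?_, ?_⟩
      · simp only [← Multiset.singleton_add]
        abel
      · convert ChainTri.node (ChainTri.node hL hR1) hR2 using 1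
        simp only [← Multiset.singleton_add]
        abel
    · have bL := hL.bounds _ _ _ h1
      have h2 : (j, k, l) ∈ L := by
        rcases h2 with h2 | h2 | h2
        · omega
        · exact h2
        · have := hR.bounds _ _ _ h2
          omega
      obtain ⟨U, rfl, hU⟩ := ihL h1 h2
      refine ⟨(a, b, c) ::ₘ (U + R), ?_, ?_⟩
      · simp only [← Multiset.singleton_add]
        abel
      · convert ChainTri.node hU hR using 1
        simp only [← Multiset.singleton_add]
        abel
    · have bR := hR.bounds _ _ _ h1
      have h2 : (j, k, l) ∈ R := by
        rcases h2 with h2 | h2 | h2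
        · omega
        · have := hL.bounds _ _ _ h2
          omega
        · exact h2
      obtain ⟨U, rfl, hU⟩ := ihR h1 h2
      refine ⟨(a, b, c) ::ₘ (L + U), ?_, ?_⟩
      · simp only [← Multiset.singleton_add]
        abel
      · convert ChainTri.node hL hU using 1
        simp only [← Multiset.singleton_add]
        abel

/-- Two triangles `(x, y, z)` and `(x, z, w)` of a triangulation, up to rotation, can be replaced
by `(x, y, w)` and `(y, z, w)`. -/
theorem flip {t t' : ℕ × ℕ × ℕ} {x y z w : ℕ} (h : ChainTri a c S) (ht : t ∈ S) (ht' : t' ∈ S)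
    (hr : IsRot t x y z) (hr' : IsRot t' x z w) :
    ∃ U t₁ t₂, S = t ::ₘ t' ::ₘ U ∧ ChainTri a c (t₁ ::ₘ t₂ ::ₘ U) ∧
      IsRot t₁ x y w ∧ IsRot t₂ y z w := by
  rcases hr with rfl | rfl | rfl <;> rcases hr' with rfl | rfl | rfl <;>
    have b1 := h.bounds _ _ _ ht <;> have b2 := h.bounds _ _ _ ht' <;> try omega
  · obtain ⟨U, h1, h2⟩ := h.flip_up ht ht'
    exact ⟨U, _, _, h1, h2, Or.inl rfl, Or.inl rfl⟩
  · obtain ⟨U, h1, h2⟩ := h.flip_down ht' ht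
    exact ⟨U, (w, x, y), (w, y, z), by rw [h1, Multiset.cons_swap], h2,
      Or.inr (Or.inr rfl), Or.inr (Or.inr rfl)⟩
  · obtain ⟨U, h1, h2⟩ := h.flip_down ht ht'
    exact ⟨U, (y, w, x), (y, z, w), h1, by rwa [Multiset.cons_swap],
      Or.inr (Or.inl rfl), Or.inl rfl⟩
  · obtain ⟨U, h1, h2⟩ := h.flip_up ht' ht
    exact ⟨U, (w, x, y), (z, w, y), by rw [h1, Multiset.cons_swap],
      by rwa [Multiset.cons_swap], Or.inr (Or.inr rfl), Or.inr (Or.inl rfl)⟩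

/-- Every boundary edge of a triangulated polygon belongs to a triangle. -/
theorem exists_hasEdge_boundary (h : ChainTri a c S) (hac : a + 1 < c) :
    (∀ k, a ≤ k → k < c → ∃ t ∈ S, HasEdge t k (k + 1)) ∧ ∃ t ∈ S, HasEdge t c a := by
  induction h with
  | edge => omega
  | @node a b c L R hL hR ihL ihR =>
    have h1 := hL.lt
    have h2 := hR.lt
    refine ⟨fun k hk1 hk2 => ?_, (a, b, c), Multiset.mem_cons_self _ _, Or.inr (Or.inr ⟨rfl, rfl⟩)⟩
    rcases lt_or_ge k b with hk | hk
    · rcases Nat.lt_or_ge (a + 1) b with hb | hb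
      · obtain ⟨t, ht, he⟩ := (ihL hb).1 k hk1 hk
        exact ⟨t, by simp [ht], he⟩
      · exact ⟨(a, b, c), Multiset.mem_cons_self _ _,
          Or.inl ⟨by dsimp only; omega, by dsimp only; omega⟩⟩
    · rcases Nat.lt_or_ge (b + 1) c with hb | hb
      · obtain ⟨t, ht, he⟩ := (ihR hb).1 k hk hk2
        exact ⟨t, by simp [ht], he⟩
      · exact ⟨(a, b, c), Multiset.mem_cons_self _ _,
          Or.inr (Or.inl ⟨by dsimp only; omega, by dsimp only; omega⟩)⟩

/-- Every edge of a triangle is a boundary edge of the polygon or also belongs, with the opposite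
direction, to another triangle. -/
theorem exists_hasEdge_symm (h : ChainTri a c S) {t : ℕ × ℕ × ℕ} (ht : t ∈ S) {x y : ℕ}
    (he : HasEdge t x y) :
    (∃ t' ∈ S, HasEdge t' y x) ∨ (a ≤ x ∧ x < c ∧ y = x + 1) ∨ (x = c ∧ y = a) := by
  induction h with
  | edge => simp at ht
  | @node a b c L R hL hR ihL ihR =>
    have h1 := hL.lt
    have h2 := hR.lt
    simp only [Multiset.mem_cons, Multiset.mem_add] at ht
    rcases ht with rfl | ht | ht
    · rcases he with ⟨hx, hy⟩ | ⟨hx, hy⟩ | ⟨hx, hy⟩ <;> dsimp only at hx hy <;> rw [hx, hy]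
      · rcases Nat.lt_or_ge (a + 1) b with hb | hb
        · obtain ⟨t, ht, he⟩ := (hL.exists_hasEdge_boundary hb).2
          exact Or.inl ⟨t, by simp [ht], he⟩
        · right; left; omega
      · rcases Nat.lt_or_ge (b + 1) c with hb | hb
        · obtain ⟨t, ht, he⟩ := (hR.exists_hasEdge_boundary hb).2
          exact Or.inl ⟨t, by simp [ht], he⟩
        · right; left; omega
      · right; right; exact ⟨rfl, rfl⟩
    · rcases ihL ht with ⟨t', ht', he'⟩ | h | h
      · exact Or.inl ⟨t', by simp [ht'], he'⟩
      · right; left; omega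
      · obtain ⟨rfl, rfl⟩ := h
        exact Or.inl ⟨_, Multiset.mem_cons_self _ _, Or.inl ⟨rfl, rfl⟩⟩
    · rcases ihR ht with ⟨t', ht', he'⟩ | h | h
      · exact Or.inl ⟨t', by simp [ht'], he'⟩
      · right; left; omega
      · obtain ⟨rfl, rfl⟩ := h
        exact Or.inl ⟨_, Multiset.mem_cons_self _ _, Or.inr (Or.inl ⟨rfl, rfl⟩)⟩

/-- In the sum over all triangles of an antisymmetric function of directed edges, the diagonals
cancel. -/
theorem sum_boundary (h : ChainTri a c S) (φ : ℕ → ℕ → ℤ) (hφ : ∀ x y, φ y x = -φ x y) :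
    (S.map fun t => φ t.1 t.2.1 + φ t.2.1 t.2.2 + φ t.2.2 t.1).sum =
      ∑ k ∈ Finset.Ico a c, φ k (k + 1) + φ c a := by
  induction h with
  | edge a => simp [hφ a (a + 1)]
  | @node a b c L R hL hR ihL ihR =>
    rw [Multiset.map_cons, Multiset.sum_cons, Multiset.map_add, Multiset.sum_add, ihL, ihR,
      ← Finset.sum_Ico_consecutive _ hL.lt.le hR.lt.le]
    have h1 := hφ a b
    have h2 := hφ b c
    linarith

end ChainTri

/-! ### Signed areas -/

/-- Twice the signed area of the triangle `p q r`, multiplied by `s`. The factor `s` allows for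
labellings of a point set in clockwise order. -/
def orient (s : ℝ) (p q r : ℂ) : ℝ :=
  s * ((q.re - p.re) * (r.im - p.im) - (q.im - p.im) * (r.re - p.re))

variable {s : ℝ}

theorem orient_rot (p q r : ℂ) : orient s q r p = orient s p q r := by
  unfold orient; ring

theorem orient_swap (p q r : ℂ) : orient s q p r = -orient s p q r := by
  unfold orient; ring

theorem orient_swap_right (p q r : ℂ) : orient s p r q = -orient s p q r := by
  unfold orient; ring

theorem orient_self_left (p q : ℂ) : orient s p q p = 0 := by
  unfold orient; ring

theorem orient_self_right (p q : ℂ) : orient s p q q = 0 := by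
  unfold orient; ring

theorem orient_self (p q : ℂ) : orient s p p q = 0 := by
  unfold orient; ring

theorem orient_lineMap (p q x y : ℂ) (r : ℝ) :
    orient s p q (AffineMap.lineMap x y r) = (1 - r) * orient s p q x + r * orient s p q y := by
  simp only [orient, AffineMap.lineMap_apply, vsub_eq_sub, vadd_eq_add, Complex.add_re,
    Complex.add_im, Complex.real_smul, Complex.mul_re, Complex.mul_im, Complex.ofReal_re,
    Complex.ofReal_im, Complex.sub_re, Complex.sub_im]
  ring

theorem orient_add_orient (x u v w : ℂ) :
    orient s x v w + orient s x w u + orient s x u v = orient s u v w := by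
  unfold orient; ring

theorem continuous_orient : Continuous fun x : ℂ × ℂ × ℂ => orient s x.1 x.2.1 x.2.2 := by
  unfold orient; fun_prop

theorem orient_eq_mul (p q r : ℂ) : orient s p q r = s * orient 1 p q r := by
  unfold orient; ring

theorem collinear_of_orient_eq_zero (hs : s ≠ 0) {p q r : ℂ} (h : orient s p q r = 0) :
    Collinear ℝ {p, q, r} := by
  have h0 : (q.re - p.re) * (r.im - p.im) - (q.im - p.im) * (r.re - p.re) = 0 := by
    simpa [orient, hs] using h
  rcases eq_or_ne p q with rfl | hpq
  · simpa using collinear_pair ℝ p r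
  have hn : (q.re - p.re) ^ 2 + (q.im - p.im) ^ 2 ≠ 0 := by
    intro h1
    apply hpq
    apply Complex.ext <;> nlinarith [sq_nonneg (q.re - p.re), sq_nonneg (q.im - p.im)]
  rw [collinear_iff_of_mem (p₀ := p) (by simp)]
  refine ⟨q - p, ?_⟩
  simp only [Set.mem_insert_iff, Set.mem_singleton_iff, forall_eq_or_imp, forall_eq]
  refine ⟨⟨0, by simp⟩, ⟨1, by simp⟩,
    ((q.re - p.re) * (r.re - p.re) + (q.im - p.im) * (r.im - p.im)) /
      ((q.re - p.re) ^ 2 + (q.im - p.im) ^ 2), ?_⟩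
  apply Complex.ext
  · simp only [vadd_eq_add, Complex.add_re, Complex.real_smul, Complex.mul_re, Complex.ofReal_re,
      Complex.ofReal_im, Complex.sub_re]
    field_simp
    linear_combination (-(q.im - p.im)) * h0
  · simp only [vadd_eq_add, Complex.add_im, Complex.real_smul, Complex.mul_im, Complex.ofReal_re,
      Complex.ofReal_im, Complex.sub_im]
    field_simp
    linear_combination ((q.re - p.re)) * h0

/-! ### From nonnegative to positive triangulations -/

/-- The signed area (twice, times `s`) of the triangle with vertices labelled by `t`. -/
def triOrient (s : ℝ) (q : ℕ → ℂ) (t : ℕ × ℕ × ℕ) : ℝ :=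
  orient s (q t.1) (q t.2.1) (q t.2.2)

/-- The perimeter of the triangle with vertices labelled by `t`. -/
def perimeter (q : ℕ → ℂ) (t : ℕ × ℕ × ℕ) : ℝ :=
  dist (q t.1) (q t.2.1) + dist (q t.2.1) (q t.2.2) + dist (q t.2.2) (q t.1)

theorem IsRot.triOrient_eq {q : ℕ → ℂ} {t : ℕ × ℕ × ℕ} {x y z : ℕ} (h : IsRot t x y z) :
    triOrient s q t = orient s (q x) (q y) (q z) := by
  rcases h with rfl | rfl | rfl
  · rfl
  · exact orient_rot _ _ _
  · exact (orient_rot _ _ _).symm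

theorem IsRot.perimeter_eq {q : ℕ → ℂ} {t : ℕ × ℕ × ℕ} {x y z : ℕ} (h : IsRot t x y z) :
    perimeter q t = dist (q x) (q y) + dist (q y) (q z) + dist (q z) (q x) := by
  rcases h with rfl | rfl | rfl <;> simp only [perimeter] <;> ring

theorem IsRot.hasEdge {t : ℕ × ℕ × ℕ} {x y z : ℕ} (h : IsRot t x y z) : HasEdge t z x := by
  rcases h with rfl | rfl | rfl
  · exact Or.inr (Or.inr ⟨rfl, rfl⟩)
  · exact Or.inr (Or.inl ⟨rfl, rfl⟩)
  · exact Or.inl ⟨rfl, rfl⟩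

theorem ChainTri.isRot_bounds {a c : ℕ} {S : Multiset (ℕ × ℕ × ℕ)} (hS : ChainTri a c S)
    {t : ℕ × ℕ × ℕ} (ht : t ∈ S) {x y z : ℕ} (h : IsRot t x y z) :
    x ≤ c ∧ y ≤ c ∧ z ≤ c ∧ x ≠ y ∧ y ≠ z ∧ z ≠ x := by
  rcases h with rfl | rfl | rfl <;> have := hS.bounds _ _ _ ht <;> omega

/-- A degenerate triangle with distinct vertices has a vertex strictly between the other two. -/
theorem exists_isRot_sbtw (hs : s ≠ 0) {q : ℕ → ℂ} {t : ℕ × ℕ × ℕ} (h1 : q t.1 ≠ q t.2.1)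
    (h2 : q t.2.1 ≠ q t.2.2) (h3 : q t.2.2 ≠ q t.1) (h : triOrient s q t = 0) :
    ∃ x y z, IsRot t x y z ∧ Sbtw ℝ (q x) (q y) (q z) := by
  rcases (collinear_of_orient_eq_zero hs h).wbtw_or_wbtw_or_wbtw with h | h | h
  · exact ⟨_, _, _, Or.inl rfl, h, h1.symm, h2⟩
  · exact ⟨t.2.1, t.2.2, t.1, Or.inr (Or.inr rfl), h, h2.symm, h3⟩
  · exact ⟨t.2.2, t.1, t.2.1, Or.inr (Or.inl rfl), h, h3.symm, h1⟩

/-- If a polygon, none of whose vertices lies in the interior of one of its edges, has a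
triangulation without negatively oriented triangles, then it has one in which all triangles are
positively oriented. In a triangulation with as few degenerate triangles as possible, and among
those of least total perimeter, a longest degenerate triangle could be removed by a flip of its
longest edge. -/
theorem exists_chainTri_pos (hs : s ≠ 0) {N : ℕ} {q : ℕ → ℂ}
    (hq : ∀ i ≤ N, ∀ j ≤ N, q i = q j → i = j)
    (hedge : ∀ k < N, ∀ j ≤ N, ¬ Sbtw ℝ (q k) (q j) (q (k + 1)))
    (hclose : ∀ j ≤ N, ¬ Sbtw ℝ (q N) (q j) (q 0))
    {S₀ : Multiset (ℕ × ℕ × ℕ)} (hS₀ : ChainTri 0 N S₀) (h₀ : ∀ t ∈ S₀, 0 ≤ triOrient s q t) :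
    ∃ S, ChainTri 0 N S ∧ ∀ t ∈ S, 0 < triOrient s q t := by
  classical
  obtain ⟨K, hK⟩ : ∃ K, ∀ i ≤ N, ∀ j ≤ N, 2 * dist (q i) (q j) < K := by
    have hfin : (Set.image2 (fun i j => 2 * dist (q i) (q j)) (Set.Iic N) (Set.Iic N)).Finite :=
      (Set.finite_Iic N).image2 _ (Set.finite_Iic N)
    obtain ⟨K, hK⟩ := hfin.bddAbove
    exact ⟨K + 1, fun i hi j hj => lt_of_le_of_lt (hK ⟨i, hi, j, hj, rfl⟩) (lt_add_one K)⟩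
  -- The constant `K` is so large that a smaller number of degenerate triangles outweighs any
  -- change of the perimeters in a flip.
  let cost : ℕ × ℕ × ℕ → ℝ := fun t => perimeter q t + if triOrient s q t = 0 then K else 0
  have hfin : {S | ChainTri 0 N S ∧ ∀ t ∈ S, 0 ≤ triOrient s q t}.Finite :=
    (ChainTri.finite 0 N).subset fun S hS => hS.1
  obtain ⟨S, ⟨hS, hS0⟩, hmin⟩ :=
    Set.exists_min_image _ (fun S => (Multiset.map cost S).sum) hfin ⟨S₀, hS₀, h₀⟩
  refine ⟨S, hS, fun t₀ ht₀ => lt_of_le_of_ne (hS0 t₀ ht₀) fun hz₀ => ?_⟩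
  obtain ⟨t, ht, htmax⟩ := Finset.exists_max_image
    (S.toFinset.filter fun t => triOrient s q t = 0) (perimeter q) ⟨t₀, by simp [ht₀, ← hz₀]⟩
  simp only [Finset.mem_filter, Multiset.mem_toFinset] at ht htmax
  obtain ⟨ht, htz⟩ := ht
  have hb := hS.isRot_bounds ht (Or.inl rfl)
  obtain ⟨x, y, z, hr, hxyz⟩ := exists_isRot_sbtw hs
    (fun h => hb.2.2.2.1 (hq _ hb.1 _ hb.2.1 h))
    (fun h => hb.2.2.2.2.1 (hq _ hb.2.1 _ hb.2.2.1 h))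
    (fun h => hb.2.2.2.2.2 (hq _ hb.2.2.1 _ hb.1 h)) htz
  clear hb
  have hb := hS.isRot_bounds ht hr
  obtain ⟨t', ht', he'⟩ : ∃ t' ∈ S, HasEdge t' x z := by
    rcases hS.exists_hasEdge_symm ht hr.hasEdge with h | ⟨-, h1, h2⟩ | ⟨h1, h2⟩
    · exact h
    · subst h2
      exact absurd hxyz.symm (hedge _ h1 _ hb.2.1)
    · subst h1 h2
      exact absurd hxyz.symm (hclose _ hb.2.1)
  obtain ⟨w, hr'⟩ := he'.exists_isRot
  have hb' := hS.isRot_bounds ht' hr'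
  obtain ⟨U, t₁, t₂, rfl, hS', hr₁, hr₂⟩ := hS.flip ht ht' hr hr'
  -- Both new areas are positive multiples of the area of the neighbouring triangle.
  obtain ⟨r, ⟨hr0, hr1⟩, hyr⟩ : ∃ r : ℝ, (0 < r ∧ r < 1) ∧
      AffineMap.lineMap (q x) (q z) r = q y := by
    obtain ⟨r, hr, h⟩ := sbtw_iff_mem_image_Ioo_and_ne.1 hxyz |>.1
    exact ⟨r, hr, h⟩
  have e₁ : triOrient s q t₁ = r * triOrient s q t' := by
    rw [hr₁.triOrient_eq, hr'.triOrient_eq, ← hyr, ← orient_rot, ← orient_rot, orient_lineMap,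
      orient_self_right, orient_rot, orient_rot]
    rw [← orient_rot (q x)]
    ring
  have e₂ : triOrient s q t₂ = (1 - r) * triOrient s q t' := by
    rw [hr₂.triOrient_eq, hr'.triOrient_eq, ← hyr, ← orient_rot, orient_lineMap,
      orient_self_left, ← orient_rot (q x)]
    ring
  have hnn' := hS0 t' ht'
  have hle := hmin _ ⟨hS', fun u hu => by
    simp only [Multiset.mem_cons] at hu
    rcases hu with rfl | rfl | hu
    · rw [e₁]; positivity
    · rw [e₂]; exact mul_nonneg (by linarith) hnn'
    · exact hS0 u (by simp [hu])⟩
  have hyw := hK y hb.2.1 w hb'.2.2.1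
  have hper : perimeter q t₁ + perimeter q t₂ - perimeter q t - perimeter q t' =
      2 * dist (q y) (q w) - 2 * dist (q x) (q z) := by
    rw [hr₁.perimeter_eq, hr₂.perimeter_eq, hr.perimeter_eq, hr'.perimeter_eq,
      dist_comm (q w) (q y), dist_comm (q z) (q x)]
    ring
  have hxz := dist_nonneg (x := q x) (y := q z)
  simp only [Multiset.map_cons, Multiset.sum_cons, cost, htz, if_true, e₁, e₂, mul_eq_zero,
    hr0.ne', (sub_pos.2 hr1).ne', false_or] at hle
  by_cases hz' : triOrient s q t' = 0
  · simp only [hz', if_true] at hle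
    have hlong := (htmax t' ⟨ht', hz'⟩)
    rw [hr.perimeter_eq, hr'.perimeter_eq] at hlong
    have hdy := hxyz.wbtw.dist_add_dist
    have hw : Wbtw ℝ (q x) (q w) (q z) := by
      rw [← dist_add_dist_eq_iff]
      refine le_antisymm ?_ (dist_triangle _ _ _)
      rw [dist_comm (q z) (q x)] at hlong
      rw [dist_comm (q x) (q w), dist_comm (q w) (q z)]
      linarith
    obtain ⟨r', ⟨h0', h1'⟩, hwr⟩ := hw
    have hwx : q w ≠ q x := fun h => hb'.2.2.2.2.2 (hq _ hb'.2.2.1 _ hb'.1 h)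
    have hwz : q w ≠ q z := fun h => hb'.2.2.2.2.1 (hq _ hb'.2.1 _ hb'.2.2.1 h.symm)
    have h0'' : 0 < r' := lt_of_le_of_ne h0' (by rintro rfl; simp at hwr; exact hwx hwr.symm)
    have h1'' : r' < 1 := lt_of_le_of_ne h1' (by rintro rfl; simp at hwr; exact hwz hwr.symm)
    have hpos : 0 < dist (q x) (q z) := dist_pos.2 hxyz.left_ne_right
    have : dist (q y) (q w) < dist (q x) (q z) := by
      rw [← hyr, ← hwr, dist_lineMap_lineMap, Real.dist_eq]
      have : |r - r'| < 1 := abs_lt.2 ⟨by linarith, by linarith⟩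
      nlinarith
    linarith
  · simp only [hz', if_false] at hle
    linarith

/-! ### Polygons with a pocket on every side -/

/-- The first endpoint of the `k`-th side of the hull. The vertices of a double circle, and of the
point sets compared with it, are labelled `0, …, 2 n - 1` along the polygon: the even label `2 k` is
the inner point of the `k`-th side, which runs from `sideStart n k` to `2 k + 1`. -/
def sideStart (n k : ℕ) : ℕ := if k = 0 then 2 * n - 1 else 2 * k - 1

/-- All labelled points other than the endpoints of a side lie strictly to the left of that side
(to the right if `s < 0`). In particular the odd labels are in convex position. -/
def IsFramed (s : ℝ) (n : ℕ) (q : ℕ → ℂ) : Prop :=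
  ∀ k < n, ∀ j < 2 * n, j ≠ sideStart n k → j ≠ 2 * k + 1 →
    0 < orient s (q (sideStart n k)) (q (2 * k + 1)) (q j)

/-- No three labelled points are collinear (and `s ≠ 0`). -/
def LabelsGeneric (s : ℝ) (n : ℕ) (q : ℕ → ℂ) : Prop :=
  ∀ a < 2 * n, ∀ b < 2 * n, ∀ c < 2 * n, a ≠ b → b ≠ c → c ≠ a → orient s (q a) (q b) (q c) ≠ 0

variable {n : ℕ} {q : ℕ → ℂ}

theorem sideStart_zero : sideStart n 0 = 2 * n - 1 := if_pos rfl

theorem sideStart_succ (k : ℕ) : sideStart n (k + 1) = 2 * k + 1 := by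
  simp only [sideStart, Nat.add_eq_zero_iff, one_ne_zero, and_false, if_false]
  omega

theorem sideStart_lt (hn : 3 ≤ n) {k : ℕ} (hk : k < n) : sideStart n k < 2 * n := by
  unfold sideStart; split_ifs <;> omega

theorem sideStart_ne (hn : 3 ≤ n) (k : ℕ) : sideStart n k ≠ 2 * k + 1 := by
  unfold sideStart; split_ifs <;> omega

theorem sideStart_odd (hn : 3 ≤ n) (k : ℕ) : sideStart n k % 2 = 1 := by
  unfold sideStart; split_ifs <;> omega

/-- A vertex of the hull lies on a side that avoids any given other point. -/
theorem exists_side (hn : 3 ≤ n) {i j : ℕ} (hi : i < 2 * n) (hodd : i % 2 = 1) (hij : j ≠ i) :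
    ∃ m < n, (i = sideStart n m ∨ i = 2 * m + 1) ∧ j ≠ sideStart n m ∧ j ≠ 2 * m + 1 := by
  obtain ⟨k, rfl⟩ : ∃ k, i = 2 * k + 1 := ⟨i / 2, by omega⟩
  by_cases h1 : j = sideStart n k
  · by_cases h2 : k + 1 < n
    · refine ⟨k + 1, h2, Or.inl (sideStart_succ k).symm, ?_, ?_⟩
      · rwa [sideStart_succ]
      · subst h1; unfold sideStart; split_ifs <;> omega
    · refine ⟨0, by omega, Or.inl (by rw [sideStart_zero]; omega), ?_, ?_⟩
      · rw [sideStart_zero]; omega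
      · subst h1; unfold sideStart; split_ifs <;> omega
  · exact ⟨k, by omega, Or.inr rfl, h1, hij⟩

theorem IsFramed.nonneg (H : IsFramed s n q) {k j : ℕ} (hk : k < n) (hj : j < 2 * n) :
    0 ≤ orient s (q (sideStart n k)) (q (2 * k + 1)) (q j) := by
  by_cases h1 : j = sideStart n k
  · rw [h1, orient_self_left]
  by_cases h2 : j = 2 * k + 1
  · rw [h2, orient_self_right]
  exact (H k hk j hj h1 h2).le

/-- The polygon whose inner points have moved from the midpoints of the sides, at time `t = 0`,
along segments towards their positions in `q`, at time `t = 1`. -/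
def grow (n : ℕ) (q : ℕ → ℂ) (t : ℝ) (j : ℕ) : ℂ :=
  if j % 2 = 0 then
    AffineMap.lineMap (AffineMap.lineMap (q (sideStart n (j / 2))) (q (j + 1)) (1 / 2 : ℝ)) (q j) t
  else q j

theorem grow_even (t : ℝ) (k : ℕ) : grow n q t (2 * k) = AffineMap.lineMap
    (AffineMap.lineMap (q (sideStart n k)) (q (2 * k + 1)) (1 / 2 : ℝ)) (q (2 * k)) t := by
  simp [grow]

theorem grow_odd (t : ℝ) {j : ℕ} (hj : j % 2 = 1) : grow n q t j = q j := by
  simp [grow, hj]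

theorem grow_one : grow n q 1 = q := by
  funext j; simp [grow]

theorem continuous_grow (j : ℕ) : Continuous fun t => grow n q t j := by
  unfold grow
  split_ifs
  · exact AffineMap.lineMap_continuous
  · exact continuous_const

theorem orient_midpoint_pos (hn : 3 ≤ n) (H : IsFramed s n q) {i k : ℕ} (hi : i < n) (hk : k < n)
    (hik : i ≠ k) : 0 < orient s (q (sideStart n k)) (q (2 * k + 1))
      (AffineMap.lineMap (q (sideStart n i)) (q (2 * i + 1)) (1 / 2 : ℝ)) := by
  rw [orient_lineMap]
  have h1 := H.nonneg hk (sideStart_lt hn hi)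
  have h2 := H.nonneg hk (show 2 * i + 1 < 2 * n by omega)
  by_cases h : 2 * i + 1 = sideStart n k
  · have := H k hk (sideStart n i) (sideStart_lt hn hi)
      (by revert h; unfold sideStart; split_ifs <;> omega)
      (by revert h; unfold sideStart; split_ifs <;> omega)
    linarith
  · have := H k hk (2 * i + 1) (by omega) h (by omega)
    linarith

theorem orient_grow_pos (hn : 3 ≤ n) (H : IsFramed s n q) {t : ℝ} (h0 : 0 ≤ t) (h1 : t ≤ 1)
    {k j : ℕ} (hk : k < n) (hj : j < 2 * n) (hj1 : j ≠ sideStart n k) (hj2 : j ≠ 2 * k + 1)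
    (hj3 : 0 < t ∨ j ≠ 2 * k) :
    0 < orient s (q (sideStart n k)) (q (2 * k + 1)) (grow n q t j) := by
  rcases Nat.mod_two_eq_zero_or_one j with hp | hp
  · obtain ⟨i, rfl⟩ : ∃ i, j = 2 * i := ⟨j / 2, by omega⟩
    rw [grow_even, orient_lineMap]
    have hB := H k hk (2 * i) hj hj1 hj2
    by_cases hik : i = k
    · subst hik
      have h0' : 0 < t := by
        rcases hj3 with h | h
        · exact h
        · exact absurd rfl h
      rw [orient_lineMap, orient_self_left, orient_self_right]
      have := mul_pos h0' hB
      linarith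
    · have hM := orient_midpoint_pos hn H (by omega : i < n) hk hik
      rcases h0.eq_or_lt with rfl | h0
      · simpa using hM
      · exact add_pos_of_nonneg_of_pos (mul_nonneg (by linarith) hM.le) (mul_pos h0 hB)
  · rw [grow_odd t hp]
    exact H k hk j hj hj1 hj2

theorem orient_lineMap_left (u v w : ℂ) (r : ℝ) :
    orient s (AffineMap.lineMap u v r) v w = (1 - r) * orient s u v w := by
  rw [← orient_rot, orient_lineMap, orient_rot, orient_self_left]
  ring

theorem orient_lineMap_middle (u v w : ℂ) (r : ℝ) :
    orient s u (AffineMap.lineMap u v r) w = r * orient s u v w := by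
  rw [orient_rot (s := s) w, orient_lineMap, orient_self_right]
  rw [← orient_rot w u v]
  ring

/-- At time `0` the triangles incident to the midpoint of the first side are positively oriented. -/
theorem exists_chainTri_grow_zero (hn : 3 ≤ n) (H : IsFramed s n q) :
    ∃ S, ChainTri 0 (2 * n - 1) S ∧ ∀ t ∈ S, 0 < triOrient s (grow n q 0) t := by
  obtain ⟨S, hS, h⟩ := ChainTri.fan 0 (2 * n - 2)
  have e : 0 + 1 + (2 * n - 2) = 2 * n - 1 := by omega
  rw [e] at hS h
  refine ⟨S, hS, fun t ht => ?_⟩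
  obtain ⟨k, h1, h2, rfl⟩ := h t ht
  change 0 < orient s (grow n q 0 0) (grow n q 0 k) (grow n q 0 (k + 1))
  rw [← orient_rot]
  rcases Nat.mod_two_eq_zero_or_one k with hp | hp
  · obtain ⟨i, rfl⟩ : ∃ i, k = 2 * i := ⟨k / 2, by omega⟩
    have := orient_grow_pos hn H le_rfl zero_le_one (by omega : i < n) (by omega : 0 < 2 * n)
      (by have := sideStart_odd hn i; omega) (by omega) (Or.inr (by omega))
    rw [grow_even, AffineMap.lineMap_apply_zero, grow_odd 0 (by omega : (2 * i + 1) % 2 = 1),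
      orient_lineMap_left]
    linarith
  · obtain ⟨i, rfl⟩ : ∃ i, k = 2 * i + 1 := ⟨k / 2, by omega⟩
    have := orient_grow_pos hn H le_rfl zero_le_one (by omega : i + 1 < n) (by omega : 0 < 2 * n)
      (by rw [sideStart_succ]; omega) (by omega) (Or.inr (by omega))
    rw [sideStart_succ] at this
    rw [show 2 * i + 1 + 1 = 2 * (i + 1) by ring, grow_even, AffineMap.lineMap_apply_zero,
      grow_odd 0 hp, sideStart_succ, orient_lineMap_middle]
    linarith

/-- The affine function `R` that vanishes at the inner point of side `i` and at the intersection, if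
any, of the lines spanned by the sides `i` and `b` separates the growing pockets on these two sides.
The hypothesis `hm` says that `R` is nonnegative at the inner point of side `b`. -/
theorem pocket_separation (hn : 3 ≤ n) (H : IsFramed s n q) {i b : ℕ} (hi : i < n) (hb : b < n)
    (hib : i ≠ b)
    (hm : orient s (q (sideStart n i)) (q (2 * i + 1)) (q (2 * i)) *
        orient s (q (sideStart n b)) (q (2 * b + 1)) (q (2 * b)) ≤
      orient s (q (sideStart n i)) (q (2 * i + 1)) (q (2 * b)) *
        orient s (q (sideStart n b)) (q (2 * b + 1)) (q (2 * i)))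
    {t : ℝ} (h0 : 0 < t) (h1 : t < 1) {v : ℕ} (hv : v = sideStart n i ∨ v = 2 * i + 1) :
    grow n q t (2 * i) ≠ grow n q t (2 * b) ∧
      ¬ Sbtw ℝ (grow n q t (2 * i)) (grow n q t (2 * b)) (grow n q t v) := by
  set li := orient s (q (sideStart n i)) (q (2 * i + 1)) with hli
  set lb := orient s (q (sideStart n b)) (q (2 * b + 1)) with hlb
  have hii : 0 < li (q (2 * i)) := H i hi _ (by omega)
    (by have := sideStart_odd hn i; omega) (by omega)
  have hbi : 0 < lb (q (2 * i)) := H b hb _ (by omega)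
    (by have := sideStart_odd hn b; omega) (by omega)
  have hMi := orient_midpoint_pos hn H hi hb hib
  have hMb := orient_midpoint_pos hn H hb hi hib.symm
  rw [← hli] at hMb
  rw [← hlb] at hMi
  let R : ℂ → ℝ := fun x => li x * lb (q (2 * i)) - li (q (2 * i)) * lb x
  have hRi : R (grow n q t (2 * i)) < 0 := by
    have e : li (grow n q t (2 * i)) = t * li (q (2 * i)) := by
      rw [grow_even, hli, orient_lineMap, orient_lineMap, orient_self_left, orient_self_right]
      ring
    simp only [R, e]
    rw [grow_even, hlb, orient_lineMap, ← hlb]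
    have := mul_pos (mul_pos hii (sub_pos.2 h1)) hMi
    linarith
  have hRb : 0 < R (grow n q t (2 * b)) := by
    have e : lb (grow n q t (2 * b)) = t * lb (q (2 * b)) := by
      rw [grow_even, hlb, orient_lineMap, orient_lineMap, orient_self_left, orient_self_right]
      ring
    simp only [R, e]
    rw [grow_even, hli, orient_lineMap, ← hli]
    have h3 := mul_pos (mul_pos (sub_pos.2 h1) hMb) hbi
    have h4 := mul_le_mul_of_nonneg_left hm h0.le
    linarith
  have hvodd : v % 2 = 1 := by
    rcases hv with rfl | rfl
    · exact sideStart_odd hn i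
    · omega
  have hvlt : v < 2 * n := by
    rcases hv with rfl | rfl
    · exact sideStart_lt hn hi
    · omega
  have hRv : R (grow n q t v) ≤ 0 := by
    have e : li (q v) = 0 := by
      rcases hv with rfl | rfl
      · exact orient_self_left _ _
      · exact orient_self_right _ _
    rw [grow_odd t hvodd]
    simp only [R, e]
    have := mul_nonneg hii.le (H.nonneg hb hvlt)
    rw [← hlb] at this
    linarith
  refine ⟨fun h => by rw [h] at hRi; linarith, fun h => ?_⟩
  obtain ⟨r, ⟨hr0, hr1⟩, hr⟩ := h.wbtw
  rw [← hr] at hRb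
  have : R (AffineMap.lineMap (grow n q t (2 * i)) (grow n q t v) r) =
      (1 - r) * R (grow n q t (2 * i)) + r * R (grow n q t v) := by
    simp only [R, hli, hlb, orient_lineMap]
    ring
  rw [this] at hRb
  nlinarith

/-- A framed polygon whose inner points are assigned to the sides so that no exchange of two inner
points decreases the product of their distances from their sides has a positively oriented
triangulation. -/
theorem exists_chainTri_of_matching (hs : s ≠ 0) (hn : 3 ≤ n) (H : IsFramed s n q)
    (hgen : LabelsGeneric s n q)
    (hm : ∀ i < n, ∀ b < n, i ≠ b →
      orient s (q (sideStart n i)) (q (2 * i + 1)) (q (2 * i)) *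
        orient s (q (sideStart n b)) (q (2 * b + 1)) (q (2 * b)) ≤
      orient s (q (sideStart n i)) (q (2 * i + 1)) (q (2 * b)) *
        orient s (q (sideStart n b)) (q (2 * b + 1)) (q (2 * i))) :
    ∃ S, ChainTri 0 (2 * n - 1) S ∧ ∀ t ∈ S, 0 < triOrient s q t := by
  have hcont : ∀ u : ℕ × ℕ × ℕ, Continuous fun t => triOrient s (grow n q t) u := fun u =>
    continuous_orient.comp
      ((continuous_grow _).prodMk ((continuous_grow _).prodMk (continuous_grow _)))
  -- For `0 < t < 1` the growing polygon is simple.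
  have hstrict : ∀ t : ℝ, 0 < t → t < 1 →
      (∃ S, ChainTri 0 (2 * n - 1) S ∧ ∀ u ∈ S, 0 ≤ triOrient s (grow n q t) u) →
      ∃ S, ChainTri 0 (2 * n - 1) S ∧ ∀ u ∈ S, 0 < triOrient s (grow n q t) u := by
    rintro t h0 h1 ⟨S, hS, hS0⟩
    have hzero : ∀ j m, j % 2 = 1 → (j = sideStart n m ∨ j = 2 * m + 1) →
        orient s (q (sideStart n m)) (q (2 * m + 1)) (grow n q t j) = 0 := by
      rintro j m hj (rfl | rfl)
      · rw [grow_odd t hj, orient_self_left]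
      · rw [grow_odd t hj, orient_self_right]
    have hpos : ∀ j m, m < n → j < 2 * n → j ≠ sideStart n m → j ≠ 2 * m + 1 →
        0 < orient s (q (sideStart n m)) (q (2 * m + 1)) (grow n q t j) := fun j m hm hj h3 h4 =>
      orient_grow_pos hn H h0.le h1.le hm hj h3 h4 (Or.inl h0)
    have hne : ∀ i j, i < 2 * n → j < 2 * n → i % 2 = 1 → j ≠ i →
        grow n q t i ≠ grow n q t j := by
      intro i j hi hj hp hij h
      obtain ⟨m, hmn, hm1, hm2, hm3⟩ := exists_side hn hi hp hij
      have := hpos j m hmn hj hm2 hm3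
      rw [← h, hzero i m hp hm1] at this
      exact lt_irrefl _ this
    have hbtw : ∀ i v j, i < n → (v = sideStart n i ∨ v = 2 * i + 1) → j < 2 * n →
        ¬ Sbtw ℝ (grow n q t (2 * i)) (grow n q t j) (grow n q t v) := by
      intro i v j hi hv hj h
      have hvlt : v < 2 * n := by
        rcases hv with rfl | rfl
        · exact sideStart_lt hn hi
        · omega
      rcases Nat.mod_two_eq_zero_or_one j with hp | hp
      · obtain ⟨b, rfl⟩ : ∃ b, j = 2 * b := ⟨j / 2, by omega⟩
        have hib : i ≠ b := by
          rintro rfl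
          exact h.ne_left rfl
        exact (pocket_separation hn H hi (by omega) hib (hm i hi b (by omega) hib) h0 h1 hv).2 h
      · have hvj : v ≠ j := by
          rintro rfl
          exact h.ne_right rfl
        obtain ⟨m, hmn, hm1, hm2, hm3⟩ := exists_side hn hj hp hvj
        have e1 := hpos v m hmn hvlt hm2 hm3
        have e2 := hpos (2 * i) m hmn (by omega) (by have := sideStart_odd hn m; omega) (by omega)
        have e3 := hzero j m hp hm1
        obtain ⟨r, ⟨hr0, hr1⟩, hr⟩ := h.wbtw
        rw [← hr, orient_lineMap] at e3
        rcases hr0.eq_or_lt with rfl | hr0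
        · simp at e3; linarith
        · have := mul_pos hr0 e1
          have := mul_nonneg (sub_nonneg.2 hr1) e2.le
          linarith
    refine exists_chainTri_pos hs ?_ ?_ ?_ hS hS0
    · intro i hi j hj h
      by_contra hij
      rcases Nat.mod_two_eq_zero_or_one i with hp | hp
      · rcases Nat.mod_two_eq_zero_or_one j with hp' | hp'
        · obtain ⟨a, rfl⟩ : ∃ a, i = 2 * a := ⟨i / 2, by omega⟩
          obtain ⟨b, rfl⟩ : ∃ b, j = 2 * b := ⟨j / 2, by omega⟩
          exact (pocket_separation hn H (by omega) (by omega) (by omega : a ≠ b)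
            (hm a (by omega) b (by omega) (by omega)) h0 h1 (Or.inr rfl)).1 h
        · exact hne j i (by omega) (by omega) hp' hij h.symm
      · exact hne i j (by omega) (by omega) hp (Ne.symm hij) h
    · intro k hk j hj h
      rcases Nat.mod_two_eq_zero_or_one k with hp | hp
      · obtain ⟨a, rfl⟩ : ∃ a, k = 2 * a := ⟨k / 2, by omega⟩
        exact hbtw a _ j (by omega) (Or.inr rfl) (by omega) h
      · obtain ⟨a, rfl⟩ : ∃ a, k = 2 * a + 1 := ⟨k / 2, by omega⟩
        exact hbtw (a + 1) _ j (by omega) (Or.inl (sideStart_succ a).symm) (by omega) h.symm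
    · intro j hj h
      exact hbtw 0 _ j (by omega) (Or.inl sideStart_zero.symm) (by omega) h.symm
  let W : Set ℝ := {t | ∃ S, ChainTri 0 (2 * n - 1) S ∧ ∀ u ∈ S, 0 ≤ triOrient s (grow n q t) u}
  have hclosed : IsClosed W := by
    have : W = ⋃ S ∈ {S | ChainTri 0 (2 * n - 1) S},
        ⋂ u ∈ S, {t | 0 ≤ triOrient s (grow n q t) u} := by
      ext t; simp [W]
    rw [this]
    exact (ChainTri.finite _ _).isClosed_biUnion fun S _ =>
      isClosed_biInter fun u _ => isClosed_le continuous_const (hcont u)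
  have hIcc : Set.Icc (0 : ℝ) 1 ⊆ W := by
    have hz := exists_chainTri_grow_zero hn H
    refine IsClosed.Icc_subset_of_forall_exists_gt (hclosed.inter isClosed_Icc) ?_ ?_
    · obtain ⟨S, hS, h⟩ := hz
      exact ⟨S, hS, fun u hu => (h u hu).le⟩
    · rintro t ⟨htW, ht0, ht1⟩ y hy
      obtain ⟨S, hS, h⟩ : ∃ S, ChainTri 0 (2 * n - 1) S ∧
          ∀ u ∈ S, 0 < triOrient s (grow n q t) u := by
        rcases ht0.eq_or_lt with rfl | ht0
        · exact hz
        · exact hstrict t ht0 ht1 htW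
      have hev : ∀ᶠ t' in nhds t, ∀ u ∈ S.toFinset, 0 < triOrient s (grow n q t') u := by
        rw [Filter.eventually_all_finset]
        intro u hu
        exact (hcont u).continuousAt.eventually (lt_mem_nhds (h u (by simpa using hu)))
      have hev2 : ∀ᶠ t' in nhdsWithin t (Set.Ioi t), t' ∈ Set.Ioc t y :=
        Ioc_mem_nhdsGT hy
      obtain ⟨t', h3, h4⟩ := ((hev.filter_mono nhdsWithin_le_nhds).and hev2).exists
      exact ⟨t', ⟨S, hS, fun u hu => (h3 u (by simpa using hu)).le⟩, h4⟩
  obtain ⟨S, hS, h⟩ := hIcc (Set.right_mem_Icc.2 zero_le_one)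
  rw [grow_one] at h
  refine ⟨S, hS, fun u hu => lt_of_le_of_ne (h u hu) (Ne.symm ?_)⟩
  obtain ⟨a, b, c⟩ := u
  have := hS.bounds _ _ _ hu
  exact hgen a (by omega) b (by omega) c (by omega) (by omega) (by omega) (by omega)

/-! ### Crossing numbers -/

/-- The signed number of crossings (`1`, `-1` or `0`) of the directed edge from `u` to `v` with the
horizontal ray emanating from `x`, to the right if `0 < s` and to the left if `s < 0`. The endpoints
are treated in a half-open way, so that no position of `x` is exceptional. -/
def crossing (s : ℝ) (x u v : ℂ) : ℤ :=
  if u.im ≤ x.im ∧ x.im < v.im ∧ 0 < orient s x u v then 1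
  else if v.im ≤ x.im ∧ x.im < u.im ∧ orient s x u v < 0 then -1 else 0

/-- `x` lies in the interior of the positively oriented triangle `u v w`. -/
def InTri (s : ℝ) (x u v w : ℂ) : Prop :=
  0 < orient s x u v ∧ 0 < orient s x v w ∧ 0 < orient s x w u

theorem InTri.rot {x u v w : ℂ} (h : InTri s x u v w) : InTri s x v w u := ⟨h.2.1, h.2.2, h.1⟩

theorem crossing_swap (x u v : ℂ) : crossing s x v u = -crossing s x u v := by
  have h : orient s x v u = -orient s x u v := by unfold orient; ring
  unfold crossing
  simp only [h, neg_pos, neg_lt_zero]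
  split_ifs with h1 h2
  · linarith [h1.2.2, h2.2.2]
  all_goals rfl

/-- The number of signed crossings of a ray with the boundary of a positively oriented triangle is
nonnegative; it is positive if the ray starts in the interior, and only if it starts in the closed
triangle. -/
def CrossingSpec (s : ℝ) (x u v w : ℂ) : Prop :=
  0 ≤ crossing s x u v + crossing s x v w + crossing s x w u ∧
    (InTri s x u v w → 1 ≤ crossing s x u v + crossing s x v w + crossing s x w u) ∧
    (1 ≤ crossing s x u v + crossing s x v w + crossing s x w u →
      0 ≤ orient s x u v ∧ 0 ≤ orient s x v w ∧ 0 ≤ orient s x w u)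

theorem CrossingSpec.rot {x u v w : ℂ} (h : CrossingSpec s x u v w) : CrossingSpec s x v w u := by
  obtain ⟨h1, h2, h3⟩ := h
  have e : crossing s x v w + crossing s x w u + crossing s x u v =
    crossing s x u v + crossing s x v w + crossing s x w u := by ring
  refine ⟨by rwa [e], fun h => ?_, fun h => ?_⟩
  · rw [e]; exact h2 h.rot.rot
  · rw [e] at h
    obtain ⟨a, b, c⟩ := h3 h
    exact ⟨b, c, a⟩

theorem plucker (x u v w : ℂ) : (u.im - x.im) * orient s x v w + (v.im - x.im) * orient s x w u +
    (w.im - x.im) * orient s x u v = 0 := by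
  unfold orient; ring

theorem crossingSpec_low {x u v w : ℂ} (h : 0 < orient s u v w) (hu : u.im ≤ x.im)
    (hv : x.im < v.im) (hw : x.im < w.im) : CrossingSpec s x u v w := by
  have hsum := orient_add_orient (s := s) x u v w
  have hp := plucker (s := s) x u v w
  unfold CrossingSpec InTri crossing
  set A := orient s x v w
  set B := orient s x w u
  set C := orient s x u v
  have hu' : ¬ x.im < u.im := not_lt.2 hu
  have hv' : ¬ v.im ≤ x.im := not_le.2 hv
  have hw' : ¬ w.im ≤ x.im := not_le.2 hw
  simp only [hu, hv, hw, hu', hv', hw', true_and, false_and, if_false, and_false]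
  have key1 : B < 0 → 0 < C := by
    intro hB
    by_contra hC
    push Not at hC
    have h1 : 0 < (v.im - x.im) * -B := mul_pos (by linarith) (by linarith)
    have h2 : 0 ≤ (w.im - x.im) * -C := mul_nonneg (by linarith) (by linarith)
    have h3 : A < 0 := by
      by_contra hA
      have := mul_nonneg (sub_nonneg.2 hu) (not_lt.1 hA)
      linarith
    linarith
  have key2 : 0 < C → 0 ≤ B → 0 ≤ A := by
    intro hC hB
    have h1 : 0 ≤ (v.im - x.im) * B := mul_nonneg (by linarith) hB
    have h2 : 0 < (w.im - x.im) * C := mul_pos (by linarith) hC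
    by_contra hA
    have := mul_nonneg (sub_nonneg.2 hu) (neg_nonneg.2 (not_le.1 hA).le)
    linarith
  split_ifs with h1 h2 h2
  · exact ⟨by norm_num, fun h => by linarith [h.2.2], fun h => by norm_num at h⟩
  · exact ⟨by norm_num, fun _ => by norm_num, fun _ => ⟨h1.le, key2 h1 (not_lt.1 h2), not_lt.1 h2⟩⟩
  · exact absurd (key1 h2) h1
  · exact ⟨by norm_num, fun h => absurd h.1 h1, fun h => by norm_num at h⟩

theorem crossingSpec_high {x u v w : ℂ} (h : 0 < orient s u v w) (hu : x.im < u.im)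
    (hv : v.im ≤ x.im) (hw : w.im ≤ x.im) : CrossingSpec s x u v w := by
  have hsum := orient_add_orient (s := s) x u v w
  have hp := plucker (s := s) x u v w
  unfold CrossingSpec InTri crossing
  set A := orient s x v w
  set B := orient s x w u
  set C := orient s x u v
  have hu' : ¬ u.im ≤ x.im := not_le.2 hu
  have hv' : ¬ x.im < v.im := not_lt.2 hv
  have hw' : ¬ x.im < w.im := not_lt.2 hw
  simp only [hu, hv, hw, hu', hv', hw', true_and, false_and, if_false, and_false]
  have key1 : C < 0 → 0 < B := by
    intro hC
    by_contra hB
    push Not at hB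
    have h1 : 0 ≤ (x.im - v.im) * -B := mul_nonneg (by linarith) (by linarith)
    have h2 : 0 ≤ (x.im - w.im) * -C := mul_nonneg (by linarith) (by linarith)
    have h3 : A ≤ 0 := by
      by_contra hA
      have := mul_pos (sub_pos.2 hu) (not_le.1 hA)
      linarith
    linarith
  have key2 : 0 < B → 0 ≤ C → 0 ≤ A := by
    intro hB hC
    have h1 : 0 ≤ (x.im - v.im) * B := mul_nonneg (by linarith) hB.le
    have h2 : 0 ≤ (x.im - w.im) * C := mul_nonneg (by linarith) hC
    by_contra hA
    have := mul_pos (sub_pos.2 hu) (neg_pos.2 (not_le.1 hA))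
    linarith
  split_ifs with h1 h2 h2
  · exact ⟨by norm_num, fun h => by linarith [h.1], fun h => by norm_num at h⟩
  · exact absurd (key1 h1) h2
  · exact ⟨by norm_num, fun _ => by norm_num, fun _ => ⟨not_lt.1 h1, key2 h2 (not_lt.1 h1), h2.le⟩⟩
  · exact ⟨by norm_num, fun h => absurd h.2.2 h2, fun h => by norm_num at h⟩

theorem crossingSpec {x u v w : ℂ} (h : 0 < orient s u v w) : CrossingSpec s x u v w := by
  have h' : 0 < orient s v w u := by rwa [orient_rot]
  have h'' : 0 < orient s w u v := by rwa [orient_rot]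
  have hp := plucker (s := s) x u v w
  rcases le_or_gt u.im x.im with hu | hu <;> rcases le_or_gt v.im x.im with hv | hv <;>
    rcases le_or_gt w.im x.im with hw | hw
  · have hz : crossing s x u v + crossing s x v w + crossing s x w u = 0 := by
      simp [crossing, not_lt.2 hu, not_lt.2 hv, not_lt.2 hw]
    refine ⟨hz.ge, fun hin => ?_, fun h => absurd h (by rw [hz]; norm_num)⟩
    obtain ⟨h1, h2, h3⟩ := hin
    exfalso
    have e1 := mul_nonneg (sub_nonneg.2 hu) h2.le
    have e2 := mul_nonneg (sub_nonneg.2 hv) h3.le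
    have e3 := mul_nonneg (sub_nonneg.2 hw) h1.le
    have f1 : u.im = x.im := by
      have : (x.im - u.im) * orient s x v w = 0 := by linarith
      rcases mul_eq_zero.1 this with h | h <;> linarith
    have f2 : v.im = x.im := by
      have : (x.im - v.im) * orient s x w u = 0 := by linarith
      rcases mul_eq_zero.1 this with h | h <;> linarith
    simp [orient, f1, f2] at h1
  · exact (crossingSpec_high h'' hw hu hv).rot
  · exact (crossingSpec_high h' hv hw hu).rot.rot
  · exact crossingSpec_low h hu hv hw
  · exact crossingSpec_high h hu hv hw
  · exact (crossingSpec_low h' hv hw hu).rot.rot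
  · exact (crossingSpec_low h'' hw hu hv).rot
  · have hz : crossing s x u v + crossing s x v w + crossing s x w u = 0 := by
      simp [crossing, not_le.2 hu, not_le.2 hv, not_le.2 hw]
    refine ⟨hz.ge, fun hin => ?_, fun h => absurd h (by rw [hz]; norm_num)⟩
    obtain ⟨h1, h2, h3⟩ := hin
    exfalso
    have e1 := mul_pos (sub_pos.2 hu) h2
    have e2 := mul_pos (sub_pos.2 hv) h3
    have e3 := mul_pos (sub_pos.2 hw) h1
    linarith

/-! ### Crossings with the convex hull -/

theorem crossing_le_one (x u v : ℂ) : crossing s x u v ≤ 1 := by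
  unfold crossing; split_ifs <;> norm_num

theorem crossing_eq_one {x u v : ℂ} (h : 1 ≤ crossing s x u v) : u.im ≤ x.im ∧ x.im < v.im := by
  unfold crossing at h
  split_ifs at h with h1
  · exact ⟨h1.1, h1.2.1⟩
  · norm_num at h
  · norm_num at h

/-- A horizontal line meets at most one upward side of a convex polygon. -/
theorem upward_side_unique (hn : 3 ≤ n) (H : IsFramed s n q) {c : ℝ} {i j : ℕ} (hi : i < n)
    (hj : j < n) (hi1 : (q (sideStart n i)).im ≤ c) (hi2 : c < (q (2 * i + 1)).im)
    (hj1 : (q (sideStart n j)).im ≤ c) (hj2 : c < (q (2 * j + 1)).im) : i = j := by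
  by_contra hij
  have key : ∀ i j, i < n → j < n → i ≠ j → (q (sideStart n i)).im ≤ c →
      c < (q (2 * i + 1)).im → c < (q (2 * j + 1)).im →
      0 < ((q (2 * i + 1)).im - c) *
          orient s (q (sideStart n j)) (q (2 * j + 1)) (q (sideStart n i)) +
        (c - (q (sideStart n i)).im) *
          orient s (q (sideStart n j)) (q (2 * j + 1)) (q (2 * i + 1)) := by
    intro i j hi hj hij h1 h2 h3
    refine add_pos_of_pos_of_nonneg (mul_pos (sub_pos.2 h2) ?_)
      (mul_nonneg (sub_nonneg.2 h1) (H.nonneg hj (by omega)))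
    refine H j hj _ (sideStart_lt hn hi) ?_ ?_
    · unfold sideStart; split_ifs <;> omega
    · intro h
      rw [h] at h1
      linarith
  have e1 := key i j hi hj hij hi1 hi2 hj2
  have e2 := key j i hj hi (Ne.symm hij) hj1 hj2 hi2
  have : ((q (2 * i + 1)).im - c) *
          orient s (q (sideStart n j)) (q (2 * j + 1)) (q (sideStart n i)) +
        (c - (q (sideStart n i)).im) *
          orient s (q (sideStart n j)) (q (2 * j + 1)) (q (2 * i + 1)) +
      (((q (2 * j + 1)).im - c) *
          orient s (q (sideStart n i)) (q (2 * i + 1)) (q (sideStart n j)) +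
        (c - (q (sideStart n j)).im) *
          orient s (q (sideStart n i)) (q (2 * i + 1)) (q (2 * j + 1))) = 0 := by
    unfold orient; ring
  linarith

theorem sum_crossing_le_one (hn : 3 ≤ n) (H : IsFramed s n q) (x : ℂ) :
    ∑ k ∈ Finset.range n, crossing s x (q (sideStart n k)) (q (2 * k + 1)) ≤ 1 := by
  classical
  calc ∑ k ∈ Finset.range n, crossing s x (q (sideStart n k)) (q (2 * k + 1))
      ≤ ∑ k ∈ Finset.range n,
          if 1 ≤ crossing s x (q (sideStart n k)) (q (2 * k + 1)) then (1 : ℤ) else 0 := by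
        refine Finset.sum_le_sum fun k _ => ?_
        split_ifs with h
        · exact crossing_le_one _ _ _
        · omega
    _ = ((Finset.range n).filter
          fun k => 1 ≤ crossing s x (q (sideStart n k)) (q (2 * k + 1))).card := by
        rw [Finset.sum_boole]
    _ ≤ 1 := by
        norm_cast
        rw [Finset.card_le_one]
        intro i hi j hj
        simp only [Finset.mem_filter, Finset.mem_range] at hi hj
        have h1 := crossing_eq_one hi.2
        have h2 := crossing_eq_one hj.2
        exact upward_side_unique hn H hi.1 hj.1 h1.1 h1.2 h2.1 h2.2

/-- A closed sequence of plane vectors that always turns counterclockwise does not stay in an open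
half plane. -/
theorem not_forall_pos_of_turning {m : ℕ} (hm : 0 < m) {a b : ℕ → ℝ} (ha : a m = a 0)
    (hb : b m = b 0) (h : ∀ k < m, 0 < b k * a (k + 1) - a k * b (k + 1)) :
    ¬ ∀ k < m, 0 < a k := by
  intro hpos
  have hpos' : ∀ k ≤ m, 0 < a k := by
    intro k hk
    rcases hk.lt_or_eq with hk | rfl
    · exact hpos k hk
    · rw [ha]; exact hpos 0 hm
  have key : ∀ k, k < m → b (k + 1) / a (k + 1) < b 0 / a 0 := by
    intro k
    induction k with
    | zero =>
      intro hk
      have := h 0 hk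
      rw [div_lt_div_iff₀ (hpos' _ hk) (hpos' _ hk.le)]
      simp only [zero_add] at this ⊢
      linarith
    | succ k ih =>
      intro hk
      refine lt_trans ?_ (ih (by omega))
      have := h (k + 1) hk
      rw [div_lt_div_iff₀ (hpos' _ hk) (hpos' _ hk.le)]
      linarith
  have := key (m - 1) (by omega)
  rw [Nat.sub_add_cancel hm, ha, hb] at this
  exact lt_irrefl _ this

theorem not_forall_nonpos_of_turning {m : ℕ} (hm : 0 < m) {a b : ℕ → ℝ} (ha : a m = a 0)
    (hb : b m = b 0) (h : ∀ k < m, 0 < b k * a (k + 1) - a k * b (k + 1)) :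
    ¬ ∀ k < m, a k ≤ 0 := by
  intro hnp
  have hneg : ∀ j < m, a (j + 1) < 0 := by
    intro j hj
    obtain ⟨i, hi, hai, hbi⟩ : ∃ i < m, a i = a (j + 1) ∧ b i = b (j + 1) := by
      rcases Nat.lt_or_ge (j + 1) m with h1 | h1
      · exact ⟨j + 1, h1, rfl, rfl⟩
      · have : j + 1 = m := by omega
        exact ⟨0, hm, by rw [this, ha], by rw [this, hb]⟩
    have hanext : a (i + 1) ≤ 0 := by
      rcases Nat.lt_or_ge (i + 1) m with h1 | h1
      · exact hnp _ h1
      · have : i + 1 = m := by omega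
        rw [this, ha]; exact hnp 0 hm
    refine lt_of_le_of_ne (hai ▸ hnp i hi) fun h0 => ?_
    have h1 := h j hj
    have h2 := h i hi
    rw [hai, hbi, h0] at h2
    rw [h0] at h1
    have h3 := hnp j hj
    rcases le_or_gt (b (j + 1)) 0 with h4 | h4
    · nlinarith [mul_nonneg_of_nonpos_of_nonpos h3 h4]
    · nlinarith [mul_nonneg h4.le (neg_nonneg.2 hanext)]
  refine not_forall_pos_of_turning hm (a := fun k => -a k) (b := fun k => -b k) (by simp [ha])
    (by simp [hb]) (fun k hk => by have := h k hk; linarith) fun k hk => ?_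
  rcases k with _ | k
  · have := hneg (m - 1) (by omega)
    rw [Nat.sub_add_cancel hm, ha] at this
    simpa using this
  · simpa using hneg k (by omega)

theorem one_le_sum_crossing (hn : 3 ≤ n) {x : ℂ}
    (hx : ∀ k < n, 0 < orient s (q (sideStart n k)) (q (2 * k + 1)) x) :
    1 ≤ ∑ k ∈ Finset.range n, crossing s x (q (sideStart n k)) (q (2 * k + 1)) := by
  have hx' : ∀ k < n, 0 < orient s x (q (sideStart n k)) (q (2 * k + 1)) := fun k hk => by
    rw [← orient_rot]
    exact hx k hk
  have h0 : ∀ k < n, 0 ≤ crossing s x (q (sideStart n k)) (q (2 * k + 1)) := by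
    intro k hk
    unfold crossing
    split_ifs with h1 h2
    · norm_num
    · exact absurd h2.2.2 (hx' k hk).le.not_gt
    · norm_num
  obtain ⟨k, hk, h1, h2⟩ : ∃ k < n, (q (sideStart n k)).im ≤ x.im ∧
      x.im < (q (2 * k + 1)).im := by
    by_contra hcon
    push Not at hcon
    have hclose : sideStart n n = sideStart n 0 := by
      obtain ⟨m, rfl⟩ : ∃ m, n = m + 1 := ⟨n - 1, by omega⟩
      rw [sideStart_succ, sideStart_zero]
      omega
    have hturn : ∀ k < n, 0 <
        (s * ((q (sideStart n k)).re - x.re)) * ((q (sideStart n (k + 1))).im - x.im) -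
          ((q (sideStart n k)).im - x.im) * (s * ((q (sideStart n (k + 1))).re - x.re)) := by
      intro k hk
      have := hx' k hk
      rw [sideStart_succ]
      unfold orient at this
      linarith
    have hcon' : ∀ k < n, (q (sideStart n k)).im ≤ x.im → (q (sideStart n (k + 1))).im ≤ x.im :=
      fun k hk h => by rw [sideStart_succ]; exact hcon k hk h
    by_cases hz : (q (sideStart n 0)).im ≤ x.im
    · have : ∀ k ≤ n, (q (sideStart n k)).im ≤ x.im := by
        intro k
        induction k with
        | zero => exact fun _ => hz
        | succ k ih => exact fun hk => hcon' k hk (ih (by omega))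
      exact not_forall_nonpos_of_turning (by omega : 0 < n)
        (a := fun k => (q (sideStart n k)).im - x.im)
        (b := fun k => s * ((q (sideStart n k)).re - x.re)) (by simp only [hclose])
        (by simp only [hclose]) hturn fun k hk => by
          have := this k hk.le
          simpa using this
    · have : ∀ d ≤ n, ¬ (q (sideStart n (n - d))).im ≤ x.im := by
        intro d
        induction d with
        | zero => intro _; rwa [Nat.sub_zero, hclose]
        | succ d ih =>
          intro hd h
          apply ih (by omega)
          have := hcon' (n - (d + 1)) (by omega) h
          rwa [show n - (d + 1) + 1 = n - d by omega] at this
      exact not_forall_pos_of_turning (by omega : 0 < n)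
        (a := fun k => (q (sideStart n k)).im - x.im)
        (b := fun k => s * ((q (sideStart n k)).re - x.re)) (by simp only [hclose])
        (by simp only [hclose]) hturn fun k hk => by
          have := this (n - k) (by omega)
          rw [Nat.sub_sub_self hk.le] at this
          simpa using this
  calc (1 : ℤ) = crossing s x (q (sideStart n k)) (q (2 * k + 1)) := by
        rw [crossing, if_pos ⟨h1, h2, hx' k hk⟩]
    _ ≤ _ := Finset.single_le_sum (f := fun k => crossing s x (q (sideStart n k)) (q (2 * k + 1)))
        (fun k hk => h0 k (Finset.mem_range.1 hk)) (Finset.mem_range.2 hk)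

/-! ### Positively oriented triangulations are geometric triangulations -/

/-- The triangles between the sides of the hull and their inner points. -/
def pockets (n : ℕ) : Multiset (ℕ × ℕ × ℕ) :=
  (Multiset.range n).map fun k => (sideStart n k, 2 * k + 1, 2 * k)

/-- The edges of the triangles in `F`, as unordered pairs of points. -/
def faceEdges (q : ℕ → ℂ) (F : Multiset (ℕ × ℕ × ℕ)) : Set (Sym2 ℂ) :=
  {e | ∃ t ∈ F, ∃ x y, HasEdge t x y ∧ e = s(q x, q y)}

/-- The labelled points `q`, in general position and with `n` of them on the hull, together with a
positively oriented triangulation `S` of the polygon through these points. -/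
structure PosTri (s : ℝ) (n : ℕ) (q : ℕ → ℂ) (S : Multiset (ℕ × ℕ × ℕ)) : Prop where
  three_le : 3 ≤ n
  framed : IsFramed s n q
  generic : LabelsGeneric s n q
  tri : ChainTri 0 (2 * n - 1) S
  pos : ∀ t ∈ S, 0 < triOrient s q t

theorem mem_pockets {t : ℕ × ℕ × ℕ} :
    t ∈ pockets n ↔ ∃ k < n, t = (sideStart n k, 2 * k + 1, 2 * k) := by
  simp [pockets, eq_comm]

theorem LabelsGeneric.injOn (hn : 3 ≤ n) (h : LabelsGeneric s n q) {i j : ℕ} (hi : i < 2 * n)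
    (hj : j < 2 * n) (hq : q i = q j) : i = j := by
  by_contra hij
  obtain ⟨k, hk, hki, hkj⟩ : ∃ k < 2 * n, k ≠ i ∧ k ≠ j := by
    by_cases h0 : 0 ≠ i ∧ 0 ≠ j
    · exact ⟨0, by omega, h0⟩
    by_cases h1 : 1 ≠ i ∧ 1 ≠ j
    · exact ⟨1, by omega, h1⟩
    · exact ⟨2, by omega, by omega, by omega⟩
  exact h i hi j hj k hk hij (Ne.symm hkj) hki (by rw [hq, orient_self])

theorem edgeSegment_mk (a b : ℂ) : edgeSegment s(a, b) = segment ℝ a b := by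
  rw [edgeSegment, ← convexHull_pair]
  congr 1
  ext x
  simp

theorem exists_lineMap_of_mem_segment {a b x : ℂ} (h : x ∈ segment ℝ a b) :
    ∃ r : ℝ, 0 ≤ r ∧ r ≤ 1 ∧ x = AffineMap.lineMap a b r := by
  rw [segment_eq_image_lineMap] at h
  obtain ⟨r, hr, rfl⟩ := h
  exact ⟨r, hr.1, hr.2, rfl⟩

theorem LabelsGeneric.eq_of_mem_segment (h : LabelsGeneric s n q) {i x y : ℕ}
    (hi : i < 2 * n) (hx : x < 2 * n) (hy : y < 2 * n) (hxy : x ≠ y)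
    (hm : q i ∈ segment ℝ (q x) (q y)) : i = x ∨ i = y := by
  by_contra hcon
  push Not at hcon
  obtain ⟨r, -, -, hr⟩ := exists_lineMap_of_mem_segment hm
  refine h x hx y hy i hi hxy (Ne.symm hcon.2) hcon.1 ?_
  rw [hr, orient_lineMap, orient_self_left, orient_self_right]
  ring

/-- A point of a positively oriented closed triangle on the line of one edge lies on that edge. -/
theorem mem_segment_of_orient_eq_zero {x u v w : ℂ} (h : 0 < orient s u v w)
    (h0 : orient s x u v = 0) (h1 : 0 ≤ orient s x v w) (h2 : 0 ≤ orient s x w u) :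
    x ∈ segment ℝ u v := by
  have hsum := orient_add_orient (s := s) x u v w
  rw [h0, add_zero] at hsum
  have hre : orient s u v w * x.re = orient s x v w * u.re + orient s x w u * v.re +
      orient s x u v * w.re := by unfold orient; ring
  have him : orient s u v w * x.im = orient s x v w * u.im + orient s x w u * v.im +
      orient s x u v * w.im := by unfold orient; ring
  refine ⟨orient s x v w / orient s u v w, orient s x w u / orient s u v w,
    div_nonneg h1 h.le, div_nonneg h2 h.le, by rw [← add_div, hsum, div_self h.ne'], ?_⟩
  apply Complex.ext
  · simp only [Complex.add_re, Complex.real_smul, Complex.mul_re, Complex.ofReal_re,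
      Complex.ofReal_im]
    field_simp
    rw [h0] at hre
    linarith
  · simp only [Complex.add_im, Complex.real_smul, Complex.mul_im, Complex.ofReal_re,
      Complex.ofReal_im]
    field_simp
    rw [h0] at him
    linarith

open Filter Topology in
/-- A ray that starts at an interior point of an edge of a triangle and points to the side of the
triangle enters the interior of the triangle. -/
theorem eventually_inTri_of_edge {u v w d z : ℂ} (h : 0 < orient s u v w)
    {r : ℝ} (hr0 : 0 < r) (hr1 : r < 1) (hz : z = AffineMap.lineMap u v r)
    (hd : 0 < orient s u v (z + d)) :
    ∀ᶠ δ : ℝ in 𝓝[>] 0, InTri s (AffineMap.lineMap z (z + d) δ) u v w := by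
  have hz0 : orient s u v z = 0 := by
    rw [hz, orient_lineMap, orient_self_left, orient_self_right]; ring
  have h1 : 0 < orient s v w z := by
    rw [hz, orient_lineMap, orient_self_left, orient_rot]
    have := mul_pos (sub_pos.2 hr1) h
    linarith
  have h2 : 0 < orient s w u z := by
    rw [hz, orient_lineMap, orient_self_right, ← orient_rot w u v]
    have := mul_pos hr0 h
    linarith
  have hc : ∀ a b : ℂ, Tendsto (fun δ : ℝ => orient s a b (AffineMap.lineMap z (z + d) δ)) (𝓝 0)
      (𝓝 (orient s a b z)) := by
    intro a b
    have : Continuous fun δ : ℝ => orient s a b (AffineMap.lineMap z (z + d) δ) :=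
      continuous_orient.comp (continuous_const.prodMk
        (continuous_const.prodMk AffineMap.lineMap_continuous))
    simpa using this.tendsto 0
  filter_upwards [self_mem_nhdsWithin, ((hc v w).eventually (lt_mem_nhds h1)).filter_mono
    nhdsWithin_le_nhds, ((hc w u).eventually (lt_mem_nhds h2)).filter_mono nhdsWithin_le_nhds]
    with δ hδ e1 e2
  refine ⟨?_, by rwa [← orient_rot], by rwa [← orient_rot]⟩
  rw [← orient_rot, orient_lineMap, hz0]
  have := mul_pos (Set.mem_Ioi.1 hδ) hd
  linarith

open Filter Topology in
theorem eventually_inTri_of_vertex {u v w : ℂ} (h : 0 < orient s u v w) :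
    ∀ᶠ δ : ℝ in 𝓝[>] 0,
      InTri s (AffineMap.lineMap u (AffineMap.lineMap v w (1 / 2 : ℝ)) δ) u v w := by
  have h1 : 0 < orient s v w u := by rwa [orient_rot]
  have hc : Tendsto (fun δ : ℝ => orient s v w
      (AffineMap.lineMap u (AffineMap.lineMap v w (1 / 2 : ℝ)) δ)) (𝓝 0) (𝓝 (orient s v w u)) := by
    have : Continuous fun δ : ℝ => orient s v w
        (AffineMap.lineMap u (AffineMap.lineMap v w (1 / 2 : ℝ)) δ) :=
      continuous_orient.comp (continuous_const.prodMk
        (continuous_const.prodMk AffineMap.lineMap_continuous))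
    simpa using this.tendsto 0
  filter_upwards [self_mem_nhdsWithin, (hc.eventually (lt_mem_nhds h1)).filter_mono
    nhdsWithin_le_nhds] with δ hδ e1
  have hδ := mul_pos (Set.mem_Ioi.1 hδ) h
  refine ⟨?_, by rwa [← orient_rot], ?_⟩
  · rw [← orient_rot, orient_lineMap, orient_lineMap, orient_self_left, orient_self_right]
    linarith
  · rw [← orient_rot, orient_lineMap, orient_lineMap, orient_self_left, orient_self_right,
      ← orient_rot w u v]
    linarith

open Filter Topology in
theorem eventually_inTri_of_inTri {x y u v w : ℂ} (h : InTri s x u v w) :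
    ∀ᶠ δ : ℝ in 𝓝[>] 0, InTri s (AffineMap.lineMap x y δ) u v w := by
  have hc : ∀ a b : ℂ, Tendsto (fun δ : ℝ => orient s (AffineMap.lineMap x y δ) a b) (𝓝[>] 0)
      (𝓝 (orient s x a b)) := by
    intro a b
    have : Continuous fun δ : ℝ => orient s (AffineMap.lineMap x y δ) a b :=
      continuous_orient.comp (AffineMap.lineMap_continuous.prodMk
        (continuous_const.prodMk continuous_const))
    exact Tendsto.mono_left (by simpa using this.tendsto 0) nhdsWithin_le_nhds
  exact ((hc u v).eventually (lt_mem_nhds h.1)).and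
    (((hc v w).eventually (lt_mem_nhds h.2.1)).and ((hc w u).eventually (lt_mem_nhds h.2.2)))

/-- `x` lies in the interior of the triangle with vertices labelled by `t`. -/
def InFace (s : ℝ) (q : ℕ → ℂ) (x : ℂ) (t : ℕ × ℕ × ℕ) : Prop :=
  InTri s x (q t.1) (q t.2.1) (q t.2.2)

theorem IsRot.inFace_iff {t : ℕ × ℕ × ℕ} {a b c : ℕ} (h : IsRot t a b c) {x : ℂ} :
    InFace s q x t ↔ InTri s x (q a) (q b) (q c) := by
  rcases h with rfl | rfl | rfl
  · rfl
  · exact ⟨fun h => h.rot.rot, fun h => h.rot⟩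
  · exact ⟨fun h => h.rot, fun h => h.rot.rot⟩

namespace PosTri

variable {S : Multiset (ℕ × ℕ × ℕ)}

theorem face_spec (h : PosTri s n q S) {t : ℕ × ℕ × ℕ} (ht : t ∈ S + pockets n) :
    0 < triOrient s q t ∧ t.1 < 2 * n ∧ t.2.1 < 2 * n ∧ t.2.2 < 2 * n ∧
      t.1 ≠ t.2.1 ∧ t.2.1 ≠ t.2.2 ∧ t.2.2 ≠ t.1 := by
  have hn := h.three_le
  rcases Multiset.mem_add.1 ht with ht | ht
  · obtain ⟨a, b, c⟩ := t
    have := h.tri.bounds _ _ _ ht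
    exact ⟨h.pos _ ht, by dsimp only; omega⟩
  · obtain ⟨k, hk, rfl⟩ := mem_pockets.1 ht
    have h1 := sideStart_lt hn hk
    have h2 := sideStart_odd hn k
    have h3 := sideStart_ne hn k
    exact ⟨h.framed k hk (2 * k) (by omega) (by omega) (by omega), by dsimp only; omega⟩

theorem hasEdge_spec (h : PosTri s n q S) {t : ℕ × ℕ × ℕ} (ht : t ∈ S + pockets n) {x y : ℕ}
    (he : HasEdge t x y) : x < 2 * n ∧ y < 2 * n ∧ x ≠ y := by
  have := h.face_spec ht
  rcases he with ⟨rfl, rfl⟩ | ⟨rfl, rfl⟩ | ⟨rfl, rfl⟩ <;> simp_all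

theorem exists_pocket (k : ℕ) (hk : k < n) :
    (sideStart n k, 2 * k + 1, 2 * k) ∈ S + pockets n :=
  Multiset.mem_add.2 (Or.inr (mem_pockets.2 ⟨k, hk, rfl⟩))

/-- Every label is a vertex of a face. -/
theorem exists_isRot (i : ℕ) (hi : i < 2 * n) : ∃ t ∈ S + pockets n, ∃ b c, IsRot t i b c := by
  refine ⟨_, exists_pocket (i / 2) (by omega), ?_⟩
  rcases Nat.mod_two_eq_zero_or_one i with hp | hp
  · exact ⟨sideStart n (i / 2), 2 * (i / 2) + 1, Or.inr (Or.inl (by congr; omega))⟩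
  · exact ⟨2 * (i / 2), sideStart n (i / 2), Or.inr (Or.inr (by congr; omega))⟩

/-- Every directed edge of a face is a side of the hull or is the reverse of an edge of another
face. -/
theorem exists_hasEdge_symm (h : PosTri s n q S) {t : ℕ × ℕ × ℕ} (ht : t ∈ S + pockets n) {x y : ℕ}
    (he : HasEdge t x y) : (∃ t' ∈ S + pockets n, HasEdge t' y x) ∨
      ∃ k < n, x = sideStart n k ∧ y = 2 * k + 1 := by
  have hn := h.three_le
  rcases Multiset.mem_add.1 ht with ht | ht
  · rcases h.tri.exists_hasEdge_symm ht he with ⟨t', ht', he'⟩ | ⟨-, h1, rfl⟩ | ⟨rfl, rfl⟩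
    · exact Or.inl ⟨t', Multiset.mem_add.2 (Or.inl ht'), he'⟩
    · left
      rcases Nat.mod_two_eq_zero_or_one x with hp | hp
      · obtain ⟨k, rfl⟩ : ∃ k, x = 2 * k := ⟨x / 2, by omega⟩
        exact ⟨_, exists_pocket k (by omega), Or.inr (Or.inl ⟨rfl, rfl⟩)⟩
      · obtain ⟨k, rfl⟩ : ∃ k, x = 2 * k + 1 := ⟨x / 2, by omega⟩
        exact ⟨_, exists_pocket (k + 1) (by omega), Or.inr (Or.inr
          ⟨rfl, (sideStart_succ (n := n) k).symm⟩)⟩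
    · exact Or.inl ⟨_, exists_pocket 0 (by omega), Or.inr (Or.inr ⟨rfl, sideStart_zero.symm⟩)⟩
  · obtain ⟨k, hk, rfl⟩ := mem_pockets.1 ht
    obtain ⟨hb1, hb2⟩ := h.tri.exists_hasEdge_boundary (by omega)
    rcases he with ⟨hx, hy⟩ | ⟨hx, hy⟩ | ⟨hx, hy⟩ <;> dsimp only at hx hy <;> rw [hx, hy]
    · exact Or.inr ⟨k, hk, rfl, rfl⟩
    · obtain ⟨t', ht', he'⟩ := hb1 (2 * k) (by omega) (by omega)
      exact Or.inl ⟨t', Multiset.mem_add.2 (Or.inl ht'), he'⟩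
    · left
      rcases k with _ | k
      · obtain ⟨t', ht', he'⟩ := hb2
        exact ⟨t', Multiset.mem_add.2 (Or.inl ht'), by rwa [sideStart_zero]⟩
      · obtain ⟨t', ht', he'⟩ := hb1 (2 * k + 1) (by omega) (by omega)
        exact ⟨t', Multiset.mem_add.2 (Or.inl ht'), by rwa [sideStart_succ]⟩

theorem sum_polygon (φ : ℕ → ℕ → ℤ) (m : ℕ) :
    ∑ k ∈ Finset.Ico 0 (2 * (m + 1) - 1), φ k (k + 1) =
      ∑ k ∈ Finset.range (m + 1), φ (2 * k) (2 * k + 1) +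
        ∑ k ∈ Finset.range m, φ (2 * k + 1) (2 * k + 2) := by
  induction m with
  | zero => simp
  | succ m ih =>
    rw [show 2 * (m + 1 + 1) - 1 = 2 * (m + 1) - 1 + 1 + 1 by omega,
      Finset.sum_Ico_succ_top (by omega), Finset.sum_Ico_succ_top (by omega), ih,
      Finset.sum_range_succ (fun k => φ (2 * k) (2 * k + 1)) (m + 1),
      Finset.sum_range_succ (fun k => φ (2 * k + 1) (2 * k + 2)) m,
      show 2 * (m + 1) - 1 = 2 * m + 1 by omega]
    simp only [show 2 * m + 1 + 1 = 2 * m + 2 by ring, show 2 * (m + 1) = 2 * m + 2 by ring]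
    ring

/-- In the sum over all faces of an antisymmetric function of directed edges, only the sides of the
hull remain. -/
theorem sum_faces (h : PosTri s n q S) (φ : ℕ → ℕ → ℤ) (hφ : ∀ x y, φ y x = -φ x y) :
    ((S + pockets n).map fun t => φ t.1 t.2.1 + φ t.2.1 t.2.2 + φ t.2.2 t.1).sum =
      ∑ k ∈ Finset.range n, φ (sideStart n k) (2 * k + 1) := by
  obtain ⟨m, rfl⟩ : ∃ m, n = m + 1 := ⟨n - 1, by have := h.three_le; omega⟩
  have hp : ((pockets (m + 1)).map fun t => φ t.1 t.2.1 + φ t.2.1 t.2.2 + φ t.2.2 t.1).sum =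
      ∑ k ∈ Finset.range (m + 1), (φ (sideStart (m + 1) k) (2 * k + 1) +
        φ (2 * k + 1) (2 * k) + φ (2 * k) (sideStart (m + 1) k)) := by
    rw [pockets, Multiset.map_map]
    rfl
  rw [Multiset.map_add, Multiset.sum_add, h.tri.sum_boundary φ hφ, hp, sum_polygon,
    Finset.sum_add_distrib, Finset.sum_add_distrib,
    Finset.sum_range_succ' (fun k => φ (2 * k) (sideStart (m + 1) k)), sideStart_zero]
  have e1 : ∑ k ∈ Finset.range (m + 1), φ (2 * k + 1) (2 * k) =
      -∑ k ∈ Finset.range (m + 1), φ (2 * k) (2 * k + 1) := by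
    rw [← Finset.sum_neg_distrib]
    exact Finset.sum_congr rfl fun k _ => hφ _ _
  have e2 : ∑ k ∈ Finset.range m, φ (2 * (k + 1)) (sideStart (m + 1) (k + 1)) =
      -∑ k ∈ Finset.range m, φ (2 * k + 1) (2 * k + 2) := by
    rw [← Finset.sum_neg_distrib]
    exact Finset.sum_congr rfl fun k _ => by rw [sideStart_succ]; exact hφ _ _
  rw [e1, e2, hφ 0 (2 * (m + 1) - 1), mul_zero]
  ring

theorem crossingSpec_face (h : PosTri s n q S) {t : ℕ × ℕ × ℕ} (ht : t ∈ S + pockets n) (x : ℂ) :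
    CrossingSpec s x (q t.1) (q t.2.1) (q t.2.2) :=
  crossingSpec (h.face_spec ht).1

/-- The interiors of different faces are disjoint. -/
theorem eq_of_inFace (h : PosTri s n q S) {t t' : ℕ × ℕ × ℕ} (ht : t ∈ S + pockets n)
    (ht' : t' ∈ S + pockets n) {x : ℂ} (hx : InFace s q x t) (hx' : InFace s q x t') : t = t' := by
  by_contra hne
  have hsum := h.sum_faces (fun i j => crossing s x (q i) (q j)) fun i j => crossing_swap _ _ _
  have hle := sum_crossing_le_one h.three_le h.framed x
  rw [← hsum] at hle
  obtain ⟨F, hF⟩ := Multiset.exists_cons_of_mem ht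
  have ht2 : t' ∈ F := by
    rw [hF, Multiset.mem_cons] at ht'
    exact ht'.resolve_left (Ne.symm hne)
  obtain ⟨G, rfl⟩ := Multiset.exists_cons_of_mem ht2
  have h1 := (h.crossingSpec_face ht x).2.1 hx
  have h2 := (h.crossingSpec_face ht' x).2.1 hx'
  have h3 : 0 ≤ (G.map fun t => crossing s x (q t.1) (q t.2.1) + crossing s x (q t.2.1) (q t.2.2) +
      crossing s x (q t.2.2) (q t.1)).sum := by
    refine Multiset.sum_nonneg fun z hz => ?_
    obtain ⟨u, hu, rfl⟩ := Multiset.mem_map.1 hz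
    exact (h.crossingSpec_face (by rw [hF]; simp [hu]) x).1
  rw [hF] at hle
  simp only [Multiset.map_cons, Multiset.sum_cons] at hle
  linarith

/-- The closed faces cover the interior of the hull. -/
theorem exists_face (h : PosTri s n q S) {x : ℂ}
    (hx : ∀ k < n, 0 < orient s (q (sideStart n k)) (q (2 * k + 1)) x) :
    ∃ t ∈ S + pockets n, 0 ≤ orient s x (q t.1) (q t.2.1) ∧ 0 ≤ orient s x (q t.2.1) (q t.2.2) ∧
      0 ≤ orient s x (q t.2.2) (q t.1) := by
  have hsum := h.sum_faces (fun i j => crossing s x (q i) (q j)) fun i j => crossing_swap _ _ _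
  have hle := one_le_sum_crossing h.three_le hx
  rw [← hsum] at hle
  by_contra hcon
  push Not at hcon
  have : ((S + pockets n).map fun t => crossing s x (q t.1) (q t.2.1) +
      crossing s x (q t.2.1) (q t.2.2) + crossing s x (q t.2.2) (q t.1)).sum ≤ 0 := by
    refine (Multiset.sum_le_card_nsmul _ 0 fun z hz => ?_).trans_eq (smul_zero _)
    obtain ⟨u, hu, rfl⟩ := Multiset.mem_map.1 hz
    by_contra hz
    obtain ⟨h1, h2, h3⟩ := (h.crossingSpec_face hu x).2.2 (by omega)
    exact absurd h3 (hcon u hu h1 h2).not_ge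
  omega

theorem not_inFace_label (h : PosTri s n q S) {t : ℕ × ℕ × ℕ} (ht : t ∈ S + pockets n) {i : ℕ}
    (hi : i < 2 * n) : ¬ InFace s q (q i) t := by
  intro hin
  obtain ⟨t', ht', b, c, hr⟩ := exists_isRot (S := S) i hi
  have hpos := (h.face_spec ht').1
  rw [hr.triOrient_eq] at hpos
  obtain ⟨δ, h1, h2⟩ := ((eventually_inTri_of_vertex hpos).and
    (eventually_inTri_of_inTri hin)).exists
  obtain rfl := h.eq_of_inFace ht ht' h2 (hr.inFace_iff.2 h1)
  have := (hr.inFace_iff.1 hin).1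
  rw [orient_self] at this
  exact lt_irrefl _ this

theorem orient_pos_of_isRot (h : PosTri s n q S) {t : ℕ × ℕ × ℕ} (ht : t ∈ S + pockets n)
    {a b c : ℕ} (hr : IsRot t a b c) : 0 < orient s (q a) (q b) (q c) := by
  rw [← hr.triOrient_eq]
  exact (h.face_spec ht).1

/-- Interiors of edges of two different faces do not cross. -/
theorem not_cross (h : PosTri s n q S) {t t' : ℕ × ℕ × ℕ} (ht : t ∈ S + pockets n)
    (ht' : t' ∈ S + pockets n) (hne : t ≠ t') {x y x' y' : ℕ} (he : HasEdge t x y)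
    (he' : HasEdge t' x' y') {r r' : ℝ} (hr0 : 0 < r) (hr1 : r < 1) (hr0' : 0 < r') (hr1' : r' < 1)
    (hz : AffineMap.lineMap (q x) (q y) r = AffineMap.lineMap (q x') (q y') r')
    (hpar : orient s (q x) (q y) (q x') ≠ 0 ∨ orient s (q x) (q y) (q y') ≠ 0) : False := by
  have hre := congrArg Complex.re hz
  have him := congrArg Complex.im hz
  simp only [AffineMap.lineMap_apply, vsub_eq_sub, vadd_eq_add, Complex.add_re, Complex.add_im,
    Complex.real_smul, Complex.mul_re, Complex.mul_im, Complex.ofReal_re, Complex.ofReal_im,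
    Complex.sub_re, Complex.sub_im, zero_mul, sub_zero, add_zero] at hre him
  obtain ⟨w, hw⟩ := he.exists_isRot
  obtain ⟨w', hw'⟩ := he'.exists_isRot
  have hpos := h.orient_pos_of_isRot ht hw
  have hpos' := h.orient_pos_of_isRot ht' hw'
  set u := q x
  set v := q y
  set u' := q x'
  set v' := q y'
  set z := AffineMap.lineMap u v r with hzu
  obtain ⟨κ, hκ⟩ : ∃ κ, κ =
      s * ((v.re - u.re) * (v'.im - u'.im) - (v.im - u.im) * (v'.re - u'.re)) :=
    ⟨_, rfl⟩
  have e1 : orient s u v u' = -(r' * κ) := by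
    rw [hκ]; unfold orient
    linear_combination (s * (v.im - u.im)) * hre - (s * (v.re - u.re)) * him
  have e2 : orient s u v v' = (1 - r') * κ := by
    rw [hκ]; unfold orient
    linear_combination (s * (v.im - u.im)) * hre - (s * (v.re - u.re)) * him
  have hκ0 : κ ≠ 0 := by
    rintro h0
    rw [h0] at e1 e2
    simp [e1, e2] at hpar
  -- The direction `d` points to the left of both edges.
  let d : ℂ := (κ : ℝ) • ((v' - u') - (v - u))
  have hadd : ∀ a b : ℂ, orient s a b (z + d) = orient s a b z + κ * (s * ((b.re - a.re) *
      ((v'.im - u'.im) - (v.im - u.im)) - (b.im - a.im) * ((v'.re - u'.re) - (v.re - u.re)))) := by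
    intro a b
    simp only [d, orient, Complex.add_re, Complex.add_im, Complex.real_smul, Complex.mul_re,
      Complex.mul_im, Complex.ofReal_re, Complex.ofReal_im, Complex.sub_re, Complex.sub_im]
    ring
  have hd : 0 < orient s u v (z + d) := by
    rw [hadd, hzu, orient_lineMap, orient_self_left, orient_self_right]
    have : 0 < κ * κ := mul_self_pos.2 hκ0
    have e : s * ((v.re - u.re) * ((v'.im - u'.im) - (v.im - u.im)) -
        (v.im - u.im) * ((v'.re - u'.re) - (v.re - u.re))) = κ := by rw [hκ]; ring
    rw [e]
    linarith
  have hd' : 0 < orient s u' v' (z + d) := by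
    rw [hadd, hz, orient_lineMap, orient_self_left, orient_self_right]
    have : 0 < κ * κ := mul_self_pos.2 hκ0
    have e : s * ((v'.re - u'.re) * ((v'.im - u'.im) - (v.im - u.im)) -
        (v'.im - u'.im) * ((v'.re - u'.re) - (v.re - u.re))) = κ := by rw [hκ]; ring
    rw [e]
    linarith
  obtain ⟨δ, h1, h2⟩ := ((eventually_inTri_of_edge hpos hr0 hr1 hzu hd).and
    (eventually_inTri_of_edge hpos' hr0' hr1' hz hd')).exists
  exact hne (h.eq_of_inFace ht ht' (hw.inFace_iff.2 h1) (hw'.inFace_iff.2 h2))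

/-- Two edges of the triangulation meet in common endpoints only. -/
theorem mem_of_mem_segment (h : PosTri s n q S) {t t' : ℕ × ℕ × ℕ} (ht : t ∈ S + pockets n)
    (ht' : t' ∈ S + pockets n) {x y x' y' : ℕ} (he : HasEdge t x y)
    (he' : HasEdge t' x' y') (hne : ¬ ((x = x' ∧ y = y') ∨ (x = y' ∧ y = x'))) {z : ℂ}
    (hz : z ∈ segment ℝ (q x) (q y)) (hz' : z ∈ segment ℝ (q x') (q y')) :
    z = q x ∨ z = q y := by
  obtain ⟨hx, hy, hxy⟩ := h.hasEdge_spec ht he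
  obtain ⟨hx', hy', hxy'⟩ := h.hasEdge_spec ht' he'
  by_contra hcon
  push Not at hcon
  obtain ⟨r, hr0, hr1, hr⟩ := exists_lineMap_of_mem_segment hz
  obtain ⟨r', hr0', hr1', hr'⟩ := exists_lineMap_of_mem_segment hz'
  have hr0 : 0 < r := hr0.lt_of_ne (by rintro rfl; simp [hr] at hcon)
  have hr1 : r < 1 := hr1.lt_of_ne (by rintro rfl; simp [hr] at hcon)
  -- An endpoint of the second edge does not lie in the interior of the first edge.
  have hend : ∀ i < 2 * n, z ≠ q i := by
    rintro i hi rfl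
    rcases h.generic.eq_of_mem_segment hi hx hy hxy hz with rfl | rfl
    · exact hcon.1 rfl
    · exact hcon.2 rfl
  have hr0' : 0 < r' := hr0'.lt_of_ne (by rintro rfl; exact hend x' hx' (by simp [hr']))
  have hr1' : r' < 1 := hr1'.lt_of_ne (by rintro rfl; exact hend y' hy' (by simp [hr']))
  -- A side of the hull is not crossed.
  have hhull : ∀ (a b c d : ℕ) (ρ ρ' : ℝ), c < 2 * n → d < 2 * n → c ≠ d → 0 < ρ' → ρ' < 1 →
      z = AffineMap.lineMap (q a) (q b) ρ → z = AffineMap.lineMap (q c) (q d) ρ' →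
      ¬ ((a = c ∧ b = d) ∨ (a = d ∧ b = c)) → ¬ ∃ k < n, a = sideStart n k ∧ b = 2 * k + 1 := by
    rintro a b c d ρ ρ' hc hd hcd h0 h1 e1 e2 hne ⟨k, hk, rfl, rfl⟩
    have f1 : orient s (q (sideStart n k)) (q (2 * k + 1)) z = 0 := by
      rw [e1, orient_lineMap, orient_self_left, orient_self_right]; ring
    rw [e2, orient_lineMap] at f1
    have g1 := h.framed.nonneg hk hc
    have g2 := h.framed.nonneg hk hd
    have g3 : 0 < orient s (q (sideStart n k)) (q (2 * k + 1)) (q c) ∨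
        0 < orient s (q (sideStart n k)) (q (2 * k + 1)) (q d) := by
      by_cases hc' : c ≠ sideStart n k ∧ c ≠ 2 * k + 1
      · exact Or.inl (h.framed k hk c hc hc'.1 hc'.2)
      · exact Or.inr (h.framed k hk d hd (by omega) (by omega))
    rcases g3 with g3 | g3
    · have := mul_pos (sub_pos.2 h1) g3
      have := mul_nonneg h0.le g2
      linarith
    · have := mul_nonneg (sub_pos.2 h1).le g1
      have := mul_pos h0 g3
      linarith
  have hpar : orient s (q x) (q y) (q x') ≠ 0 ∨ orient s (q x) (q y) (q y') ≠ 0 := by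
    by_cases hc : x' ≠ x ∧ x' ≠ y
    · exact Or.inl (h.generic x hx y hy x' hx' hxy hc.2.symm hc.1)
    · exact Or.inr (h.generic x hx y hy y' hy' hxy (by omega) (by omega))
  by_cases htt : t = t'
  · -- The other face at the second edge differs from `t`.
    subst htt
    obtain ⟨t₂, ht₂, he₂⟩ := (h.exists_hasEdge_symm ht' he').resolve_right
      (hhull x' y' x y r' r hx hy hxy hr0 hr1 hr' hr (by omega))
    have hne₂ : t ≠ t₂ := by
      rintro rfl
      have := h.face_spec ht
      unfold HasEdge at he' he₂
      omega
    refine h.not_cross ht ht₂ hne₂ he he₂ hr0 hr1 (sub_pos.2 hr1') (sub_lt_self 1 hr0') ?_ hpar.symm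
    rw [← hr, hr', AffineMap.lineMap_apply_one_sub]
  · exact h.not_cross ht ht' htt he he' hr0 hr1 hr0' hr1' (hr.symm.trans hr') hpar

/-- A point of a closed face is interior or lies on one of its edges. -/
theorem inFace_or_mem_segment (h : PosTri s n q S) {t : ℕ × ℕ × ℕ} (ht : t ∈ S + pockets n) {x : ℂ}
    (h1 : 0 ≤ orient s x (q t.1) (q t.2.1)) (h2 : 0 ≤ orient s x (q t.2.1) (q t.2.2))
    (h3 : 0 ≤ orient s x (q t.2.2) (q t.1)) :
    InFace s q x t ∨ ∃ a b, HasEdge t a b ∧ x ∈ segment ℝ (q a) (q b) := by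
  have hpos : 0 < orient s (q t.1) (q t.2.1) (q t.2.2) := (h.face_spec ht).1
  rcases h1.eq_or_lt with e1 | e1
  · exact Or.inr ⟨_, _, Or.inl ⟨rfl, rfl⟩, mem_segment_of_orient_eq_zero hpos e1.symm h2 h3⟩
  rcases h2.eq_or_lt with e2 | e2
  · exact Or.inr ⟨_, _, Or.inr (Or.inl ⟨rfl, rfl⟩),
      mem_segment_of_orient_eq_zero (by rwa [orient_rot]) e2.symm h3 h1⟩
  rcases h3.eq_or_lt with e3 | e3
  · exact Or.inr ⟨_, _, Or.inr (Or.inr ⟨rfl, rfl⟩),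
      mem_segment_of_orient_eq_zero (by rwa [← orient_rot]) e3.symm h1 h2⟩
  · exact Or.inl ⟨e1, e2, e3⟩

/-- If the interior of the segment from `q i` to `q j` avoids the edges of a face but its midpoint
lies in the face, then `i` is a vertex of the face. -/
theorem vertex_of_midpoint (h : PosTri s n q S) {t : ℕ × ℕ × ℕ} (ht : t ∈ S + pockets n) {i j : ℕ}
    (hi : i < 2 * n)
    (hcross : ∀ r : ℝ, 0 < r → r < 1 → ∀ a b, HasEdge t a b →
      AffineMap.lineMap (q i) (q j) r ∉ segment ℝ (q a) (q b))
    (h1 : 0 ≤ orient s (AffineMap.lineMap (q i) (q j) (1 / 2 : ℝ)) (q t.1) (q t.2.1))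
    (h2 : 0 ≤ orient s (AffineMap.lineMap (q i) (q j) (1 / 2 : ℝ)) (q t.2.1) (q t.2.2))
    (h3 : 0 ≤ orient s (AffineMap.lineMap (q i) (q j) (1 / 2 : ℝ)) (q t.2.2) (q t.1)) :
    i = t.1 ∨ i = t.2.1 ∨ i = t.2.2 := by
  let g : ℝ → ℝ := fun r => min (orient s (AffineMap.lineMap (q i) (q j) r) (q t.1) (q t.2.1))
    (min (orient s (AffineMap.lineMap (q i) (q j) r) (q t.2.1) (q t.2.2))
      (orient s (AffineMap.lineMap (q i) (q j) r) (q t.2.2) (q t.1)))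
  have hgc : Continuous g := by
    have hc : ∀ a b : ℂ, Continuous fun r : ℝ => orient s (AffineMap.lineMap (q i) (q j) r) a b :=
      fun a b => continuous_orient.comp (AffineMap.lineMap_continuous.prodMk
        (continuous_const.prodMk continuous_const))
    exact (hc _ _).min ((hc _ _).min (hc _ _))
  have hg : ∀ r, 0 ≤ g r → InFace s q (AffineMap.lineMap (q i) (q j) r) t ∨
      ∃ a b, HasEdge t a b ∧ AffineMap.lineMap (q i) (q j) r ∈ segment ℝ (q a) (q b) := by
    intro r hr
    obtain ⟨e1, e2⟩ := le_min_iff.1 hr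
    obtain ⟨e2, e3⟩ := le_min_iff.1 e2
    exact h.inFace_or_mem_segment ht e1 e2 e3
  have hg0 : ∀ r, 0 < r → r < 1 → g r ≠ 0 := by
    intro r h0 h1 hz
    rcases hg r hz.ge with ⟨e1, e2, e3⟩ | ⟨a, b, hab, hm⟩
    · exact absurd hz (lt_min e1 (lt_min e2 e3)).ne'
    · exact hcross r h0 h1 a b hab hm
  have hhalf : 0 ≤ g (1 / 2) := le_min h1 (le_min h2 h3)
  have hzero : 0 ≤ g 0 := by
    by_contra hneg
    push Not at hneg
    obtain ⟨r, ⟨hr0, hr1⟩, hr⟩ := intermediate_value_Icc (by norm_num : (0 : ℝ) ≤ 1 / 2)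
      hgc.continuousOn ⟨hneg.le, hhalf⟩
    rcases hr0.eq_or_lt with rfl | hr0
    · exact hneg.ne hr
    · exact hg0 r hr0 (by linarith) hr
  have hspec := h.face_spec ht
  rcases hg 0 hzero with hin | ⟨a, b, hab, hm⟩
  · rw [AffineMap.lineMap_apply_zero] at hin
    exact absurd hin (h.not_inFace_label ht hi)
  · rw [AffineMap.lineMap_apply_zero] at hm
    obtain ⟨ha, hb, hne⟩ := h.hasEdge_spec ht hab
    have := h.generic.eq_of_mem_segment hi ha hb hne hm
    unfold HasEdge at hab
    omega

theorem isTriangulation (h : PosTri s n q S) {Q : Finset ℂ}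
    (hQ : ∀ z, z ∈ Q ↔ ∃ i < 2 * n, q i = z) :
    IsTriangulation Q (faceEdges q (S + pockets n)) := by
  refine ⟨⟨?_, ?_⟩, ?_⟩
  · rintro e ⟨t, ht, x, y, he, rfl⟩
    obtain ⟨hx, hy, hxy⟩ := h.hasEdge_spec ht he
    refine ⟨?_, ?_⟩
    · rw [Sym2.mk_isDiag_iff]
      exact fun hq => hxy (h.generic.injOn h.three_le hx hy hq)
    · intro z hz
      rw [Sym2.mem_iff] at hz
      rcases hz with rfl | rfl
      · exact (hQ _).2 ⟨x, hx, rfl⟩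
      · exact (hQ _).2 ⟨y, hy, rfl⟩
  · rintro e ⟨t, ht, x, y, he, rfl⟩ e' ⟨t', ht', x', y', he', rfl⟩ hne z ⟨hz, hz'⟩
    rw [edgeSegment_mk] at hz hz'
    have hne' : ¬ ((x = x' ∧ y = y') ∨ (x = y' ∧ y = x')) := by
      rintro (⟨rfl, rfl⟩ | ⟨rfl, rfl⟩)
      · exact hne rfl
      · exact hne Sym2.eq_swap
    rw [Sym2.mem_iff, Sym2.mem_iff]
    exact ⟨h.mem_of_mem_segment ht ht' he he' hne' hz hz',
      h.mem_of_mem_segment ht' ht he' he (by omega) hz' hz⟩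
  · rintro T hT hle e he
    obtain ⟨hdiag, hmem⟩ := hT.1 he
    induction e with
    | _ z z' =>
    obtain ⟨i, hi, rfl⟩ := (hQ z).1 (hmem z (Sym2.mem_mk_left _ _))
    obtain ⟨j, hj, rfl⟩ := (hQ z').1 (hmem z' (Sym2.mem_mk_right _ _))
    rw [Sym2.mk_isDiag_iff] at hdiag
    have hij : i ≠ j := fun h => hdiag (by rw [h])
    by_contra hnot
    have hcross : ∀ r : ℝ, 0 < r → r < 1 → ∀ t ∈ S + pockets n, ∀ a b, HasEdge t a b →
        AffineMap.lineMap (q i) (q j) r ∉ segment ℝ (q a) (q b) := by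
      intro r hr0 hr1 t ht a b hab hm
      have hT' : s(q a, q b) ∈ T := hle ⟨t, ht, a, b, hab, rfl⟩
      have hm' : AffineMap.lineMap (q i) (q j) r ∈ segment ℝ (q i) (q j) := by
        rw [segment_eq_image_lineMap]
        exact ⟨r, ⟨hr0.le, hr1.le⟩, rfl⟩
      have hne : s(q i, q j) ≠ s(q a, q b) := fun h => hnot ⟨t, ht, a, b, hab, h⟩
      have := (hT.2 _ he _ hT' hne (AffineMap.lineMap (q i) (q j) r)
        ⟨by rwa [edgeSegment_mk], by rwa [edgeSegment_mk]⟩).1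
      rw [Sym2.mem_iff, AffineMap.lineMap_eq_left_iff, AffineMap.lineMap_eq_right_iff] at this
      rcases this with (h | h) | (h | h)
      · exact hdiag h
      · exact hr0.ne' h
      · exact hdiag h
      · exact hr1.ne h
    obtain ⟨t, ht, h1, h2, h3⟩ := h.exists_face
      (x := AffineMap.lineMap (q i) (q j) (1 / 2 : ℝ)) fun k hk => by
        rw [orient_lineMap]
        have g1 := h.framed.nonneg hk hi
        have g2 := h.framed.nonneg hk hj
        by_cases hi' : i ≠ sideStart n k ∧ i ≠ 2 * k + 1
        · have := h.framed k hk i hi hi'.1 hi'.2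
          linarith
        by_cases hj' : j ≠ sideStart n k ∧ j ≠ 2 * k + 1
        · have := h.framed k hk j hj hj'.1 hj'.2
          linarith
        exfalso
        apply hnot
        refine ⟨_, exists_pocket k hk, sideStart n k, 2 * k + 1, Or.inl ⟨rfl, rfl⟩, ?_⟩
        rw [Sym2.eq_iff]
        have : (i = sideStart n k ∧ j = 2 * k + 1) ∨ (i = 2 * k + 1 ∧ j = sideStart n k) := by omega
        rcases this with ⟨rfl, rfl⟩ | ⟨rfl, rfl⟩
        · exact Or.inl ⟨rfl, rfl⟩
        · exact Or.inr ⟨rfl, rfl⟩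
    have hvi := h.vertex_of_midpoint ht hi (fun r h0 h1 => hcross r h0 h1 t ht) h1 h2 h3
    have hswap : AffineMap.lineMap (q i) (q j) (1 / 2 : ℝ) =
        AffineMap.lineMap (q j) (q i) (1 / 2 : ℝ) := by
      rw [← AffineMap.lineMap_apply_one_sub]
      norm_num
    have hvj := h.vertex_of_midpoint (j := i) ht hj (fun r h0 h1 a b hab hm =>
      hcross (1 - r) (by linarith) (by linarith) t ht a b hab
        (by rwa [AffineMap.lineMap_apply_one_sub])) (by rwa [← hswap]) (by rwa [← hswap])
        (by rwa [← hswap])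
    have : HasEdge t i j ∨ HasEdge t j i := by
      unfold HasEdge
      omega
    rcases this with hE | hE
    · exact hnot ⟨t, ht, i, j, hE, rfl⟩
    · exact hnot ⟨t, ht, j, i, hE, Sym2.eq_swap⟩

end PosTri

/-! ### Orientations in a double circle -/

/-- The orientations of the triples of a double circle, in the labelling `p` along the polygon: all
triples are counterclockwise in the order of their labels, except for those formed by a side and
its inner point. -/
structure DoubleCircleLabels (n : ℕ) (p : ℕ → ℂ) : Prop where
  three_le : 3 ≤ n
  pos : ∀ a b c, a < b → b < c → c < 2 * n → ¬ (a % 2 = 1 ∧ b = a + 1 ∧ c = a + 2) →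
    ¬ (a = 0 ∧ b = 1 ∧ c = 2 * n - 1) → 0 < orient 1 (p a) (p b) (p c)
  pocket : ∀ k < n, 0 < orient 1 (p (sideStart n k)) (p (2 * k + 1)) (p (2 * k))

/-- The points of `offsetPolygon n c w ε` in their order along the polygon, starting with the inner
point of the zeroth side. -/
def offsetLabel (n : ℕ) (c w : ℂ) (ε : ℝ) (j : ℕ) : ℂ :=
  if j % 2 = 0 then innerPoint n c w ε (j / 2) else vertex n c w (j / 2 + 1)

theorem vertex_eq (n : ℕ) (c w : ℂ) (k : ℕ) : vertex n c w k =
    c + w * Complex.exp ((2 * (Real.pi * k / n) : ℝ) * Complex.I) := by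
  unfold vertex
  congr 3
  push_cast
  ring

theorem vertex_re (n : ℕ) (c w : ℂ) (k : ℕ) : (vertex n c w k).re =
    c.re + (w.re * Real.cos (2 * (Real.pi * k / n)) - w.im * Real.sin (2 * (Real.pi * k / n))) := by
  rw [vertex_eq, Complex.add_re, Complex.mul_re, Complex.exp_ofReal_mul_I_re,
    Complex.exp_ofReal_mul_I_im]

theorem vertex_im (n : ℕ) (c w : ℂ) (k : ℕ) : (vertex n c w k).im =
    c.im + (w.re * Real.sin (2 * (Real.pi * k / n)) + w.im * Real.cos (2 * (Real.pi * k / n))) := by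
  rw [vertex_eq, Complex.add_im, Complex.mul_im, Complex.exp_ofReal_mul_I_re,
    Complex.exp_ofReal_mul_I_im]

theorem vertex_self (hn : 3 ≤ n) (c w : ℂ) : vertex n c w n = vertex n c w 0 := by
  have : (n : ℂ) ≠ 0 := by norm_cast; omega
  simp [vertex, div_self this, Complex.exp_two_pi_mul_I]

theorem orient_vertex (n : ℕ) (c w : ℂ) (x y z : ℕ) :
    orient 1 (vertex n c w x) (vertex n c w y) (vertex n c w z) =
      4 * (w.re ^ 2 + w.im ^ 2) * (Real.sin (Real.pi * y / n - Real.pi * x / n) *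
        Real.sin (Real.pi * z / n - Real.pi * y / n) *
        Real.sin (Real.pi * z / n - Real.pi * x / n)) := by
  simp only [orient, vertex_re, vertex_im, Real.sin_sub, Real.cos_two_mul', Real.sin_two_mul]
  have hx := Real.sin_sq_add_cos_sq (Real.pi * x / n)
  have hy := Real.sin_sq_add_cos_sq (Real.pi * y / n)
  have hz := Real.sin_sq_add_cos_sq (Real.pi * z / n)
  generalize Real.sin (Real.pi * x / n) = sx at *
  generalize Real.cos (Real.pi * x / n) = cx at *
  generalize Real.sin (Real.pi * y / n) = sy at *
  generalize Real.cos (Real.pi * y / n) = cy at *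
  generalize Real.sin (Real.pi * z / n) = sz at *
  generalize Real.cos (Real.pi * z / n) = cz at *
  -- The homogeneous form of the identity is a Vandermonde determinant.
  have key : (sx ^ 2 + cx ^ 2) * ((cy ^ 2 - sy ^ 2) * (2 * sz * cz) -
        (cz ^ 2 - sz ^ 2) * (2 * sy * cy)) +
      (sy ^ 2 + cy ^ 2) * ((cz ^ 2 - sz ^ 2) * (2 * sx * cx) -
        (cx ^ 2 - sx ^ 2) * (2 * sz * cz)) +
      (sz ^ 2 + cz ^ 2) * ((cx ^ 2 - sx ^ 2) * (2 * sy * cy) -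
        (cy ^ 2 - sy ^ 2) * (2 * sx * cx)) =
      4 * ((sy * cx - cy * sx) * (sz * cy - cz * sy) * (sz * cx - cz * sx)) := by ring
  rw [hx, hy, hz] at key
  linear_combination (w.re ^ 2 + w.im ^ 2) * key

theorem orient_vertex_center (n : ℕ) (c w : ℂ) (x y : ℕ) :
    orient 1 (vertex n c w x) (vertex n c w y) c =
      (w.re ^ 2 + w.im ^ 2) *
        Real.sin (2 * (Real.pi * y / n) - 2 * (Real.pi * x / n)) := by
  simp only [orient, vertex_re, vertex_im, Real.sin_sub]
  ring

theorem re_sq_add_im_sq_pos {w : ℂ} (hw : w ≠ 0) : 0 < w.re ^ 2 + w.im ^ 2 := by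
  have := Complex.normSq_pos.2 hw
  rw [Complex.normSq_apply] at this
  linarith

theorem sin_sub_nonneg (hn : 3 ≤ n) {x y : ℕ} (hxy : x ≤ y) (hyx : y ≤ x + n) :
    0 ≤ Real.sin (Real.pi * y / n - Real.pi * x / n) := by
  have hn0 : (0 : ℝ) < n := by norm_cast; omega
  have h1 : (x : ℝ) ≤ y := by exact_mod_cast hxy
  have h2 : (y : ℝ) ≤ x + n := by exact_mod_cast hyx
  rw [← sub_div, ← mul_sub]
  refine Real.sin_nonneg_of_nonneg_of_le_pi
    (div_nonneg (mul_nonneg Real.pi_pos.le (by linarith)) hn0.le) ?_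
  rw [div_le_iff₀ hn0]
  exact mul_le_mul_of_nonneg_left (by linarith) Real.pi_pos.le

theorem sin_sub_pos (hn : 3 ≤ n) {x y : ℕ} (hxy : x < y) (hyx : y < x + n) :
    0 < Real.sin (Real.pi * y / n - Real.pi * x / n) := by
  have hn0 : (0 : ℝ) < n := by norm_cast; omega
  have h1 : (x : ℝ) < y := by exact_mod_cast hxy
  have h2 : (y : ℝ) < x + n := by exact_mod_cast hyx
  rw [← sub_div, ← mul_sub]
  refine Real.sin_pos_of_pos_of_lt_pi (div_pos (mul_pos Real.pi_pos (by linarith)) hn0) ?_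
  rw [div_lt_iff₀ hn0]
  exact mul_lt_mul_of_pos_left (by linarith) Real.pi_pos

theorem orient_vertex_nonneg (hn : 3 ≤ n) (c w : ℂ) {x y z : ℕ} (hxy : x ≤ y) (hyz : y ≤ z)
    (hzx : z ≤ x + n) : 0 ≤ orient 1 (vertex n c w x) (vertex n c w y) (vertex n c w z) := by
  rw [orient_vertex]
  have h1 := sin_sub_nonneg hn hxy (by omega)
  have h2 := sin_sub_nonneg hn hyz (by omega)
  have h3 := sin_sub_nonneg hn (hxy.trans hyz) hzx
  positivity

theorem orient_vertex_pos (hn : 3 ≤ n) (c : ℂ) {w : ℂ} (hw : w ≠ 0) {x y z : ℕ} (hxy : x < y)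
    (hyz : y < z) (hzx : z < x + n) :
    0 < orient 1 (vertex n c w x) (vertex n c w y) (vertex n c w z) := by
  rw [orient_vertex]
  have h0 := re_sq_add_im_sq_pos hw
  have h1 := sin_sub_pos hn hxy (by omega)
  have h2 := sin_sub_pos hn hyz (by omega)
  have h3 := sin_sub_pos hn (hxy.trans hyz) hzx
  positivity

theorem orient_midpoint (a a' b b' c c' : ℂ) :
    8 * orient 1 (midpoint ℝ a a') (midpoint ℝ b b') (midpoint ℝ c c') =
      orient 1 a b c + orient 1 a b c' + orient 1 a b' c + orient 1 a b' c' +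
      orient 1 a' b c + orient 1 a' b c' + orient 1 a' b' c + orient 1 a' b' c' := by
  simp only [orient, midpoint_eq_smul_add, Complex.real_smul, Complex.mul_re, Complex.mul_im,
    Complex.ofReal_re, Complex.ofReal_im, Complex.add_re, Complex.add_im, invOf_eq_inv]
  ring

theorem offsetLabel_zero (n : ℕ) (c w : ℂ) (j : ℕ) : offsetLabel n c w 0 j =
    midpoint ℝ (vertex n c w ((j + 1) / 2)) (vertex n c w ((j + 2) / 2)) := by
  unfold offsetLabel
  split_ifs with h
  · rw [innerPoint, zero_div, AffineMap.lineMap_apply_zero, sideMidpoint]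
    congr 2 <;> omega
  · rw [show (j + 1) / 2 = j / 2 + 1 by omega, show (j + 2) / 2 = j / 2 + 1 by omega,
      midpoint_self]

/-- At offset `0`, where the inner points are the midpoints of the sides, the triples other than
those on a side are already counterclockwise. -/
theorem orient_offsetLabel_zero (hn : 3 ≤ n) (c : ℂ) {w : ℂ} (hw : w ≠ 0) {i j k : ℕ} (hij : i < j)
    (hjk : j < k) (hk : k < 2 * n) (h1 : ¬ (i % 2 = 1 ∧ j = i + 1 ∧ k = i + 2))
    (h2 : ¬ (i = 0 ∧ j = 1 ∧ k = 2 * n - 1)) :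
    0 < orient 1 (offsetLabel n c w 0 i) (offsetLabel n c w 0 j) (offsetLabel n c w 0 k) := by
  have hsum := orient_midpoint (vertex n c w ((i + 1) / 2)) (vertex n c w ((i + 2) / 2))
    (vertex n c w ((j + 1) / 2)) (vertex n c w ((j + 2) / 2))
    (vertex n c w ((k + 1) / 2)) (vertex n c w ((k + 2) / 2))
  simp only [offsetLabel_zero]
  have hnn : ∀ x y z : ℕ, x ≤ y → y ≤ z → z ≤ x + n →
      0 ≤ orient 1 (vertex n c w x) (vertex n c w y) (vertex n c w z) :=
    fun x y z => orient_vertex_nonneg hn c w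
  have e1 := hnn ((i + 1) / 2) ((j + 1) / 2) ((k + 1) / 2) (by omega) (by omega) (by omega)
  have e2 := hnn ((i + 1) / 2) ((j + 1) / 2) ((k + 2) / 2) (by omega) (by omega) (by omega)
  have e3 := hnn ((i + 1) / 2) ((j + 2) / 2) ((k + 1) / 2) (by omega) (by omega) (by omega)
  have e4 := hnn ((i + 1) / 2) ((j + 2) / 2) ((k + 2) / 2) (by omega) (by omega) (by omega)
  have e5 := hnn ((i + 2) / 2) ((j + 1) / 2) ((k + 1) / 2) (by omega) (by omega) (by omega)
  have e6 := hnn ((i + 2) / 2) ((j + 1) / 2) ((k + 2) / 2) (by omega) (by omega) (by omega)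
  have e7 := hnn ((i + 2) / 2) ((j + 2) / 2) ((k + 1) / 2) (by omega) (by omega) (by omega)
  have e8 := hnn ((i + 2) / 2) ((j + 2) / 2) ((k + 2) / 2) (by omega) (by omega) (by omega)
  -- Three distinct vertices can be selected from the sides and vertices `i`, `j`, `k`.
  obtain ⟨x, hx, y, hy, z, hz, hxy, hyz, hzx⟩ : ∃ x, (x = (i + 1) / 2 ∨ x = (i + 2) / 2) ∧
      ∃ y, (y = (j + 1) / 2 ∨ y = (j + 2) / 2) ∧ ∃ z, (z = (k + 1) / 2 ∨ z = (k + 2) / 2) ∧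
        x < y ∧ y < z ∧ z < x + n := by
    by_cases c1 : (i + 1) / 2 < (j + 1) / 2 ∧ (j + 1) / 2 < (k + 2) / 2 ∧
        (k + 2) / 2 < (i + 1) / 2 + n
    · exact ⟨_, Or.inl rfl, _, Or.inl rfl, _, Or.inr rfl, c1⟩
    by_cases c2 : (i + 1) / 2 < (j + 2) / 2 ∧ (j + 2) / 2 < (k + 2) / 2 ∧
        (k + 2) / 2 < (i + 1) / 2 + n
    · exact ⟨_, Or.inl rfl, _, Or.inr rfl, _, Or.inr rfl, c2⟩
    by_cases c3 : (i + 2) / 2 < (j + 1) / 2 ∧ (j + 1) / 2 < (k + 2) / 2 ∧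
        (k + 2) / 2 < (i + 2) / 2 + n
    · exact ⟨_, Or.inr rfl, _, Or.inl rfl, _, Or.inr rfl, c3⟩
    by_cases c4 : (i + 2) / 2 < (j + 2) / 2 ∧ (j + 2) / 2 < (k + 2) / 2 ∧
        (k + 2) / 2 < (i + 2) / 2 + n
    · exact ⟨_, Or.inr rfl, _, Or.inr rfl, _, Or.inr rfl, c4⟩
    by_cases c5 : (i + 1) / 2 < (j + 1) / 2 ∧ (j + 1) / 2 < (k + 1) / 2 ∧
        (k + 1) / 2 < (i + 1) / 2 + n
    · exact ⟨_, Or.inl rfl, _, Or.inl rfl, _, Or.inl rfl, c5⟩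
    by_cases c6 : (i + 1) / 2 < (j + 2) / 2 ∧ (j + 2) / 2 < (k + 1) / 2 ∧
        (k + 1) / 2 < (i + 1) / 2 + n
    · exact ⟨_, Or.inl rfl, _, Or.inr rfl, _, Or.inl rfl, c6⟩
    exfalso
    omega
  have hpos := orient_vertex_pos hn c hw hxy hyz hzx
  rcases hx with rfl | rfl <;> rcases hy with rfl | rfl <;> rcases hz with rfl | rfl <;> linarith

theorem continuous_offsetLabel (n : ℕ) (c w : ℂ) (j : ℕ) :
    Continuous fun ε => offsetLabel n c w ε j := by
  unfold offsetLabel innerPoint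
  split_ifs
  · exact AffineMap.lineMap_continuous.comp (continuous_id.div_const _)
  · exact continuous_const

theorem offsetLabel_sideStart (hn : 3 ≤ n) (c w : ℂ) (ε : ℝ) {k : ℕ} (hk : k < n) :
    offsetLabel n c w ε (sideStart n k) = vertex n c w k := by
  rw [offsetLabel, if_neg (by have := sideStart_odd hn k; omega)]
  rcases k with _ | k
  · rw [sideStart_zero, show (2 * n - 1) / 2 + 1 = n by omega, vertex_self hn]
  · rw [sideStart_succ, show (2 * k + 1) / 2 + 1 = k + 1 by omega]

theorem orient_pocket (hn : 3 ≤ n) (c : ℂ) {w : ℂ} (hw : w ≠ 0) {ε : ℝ} (hε : 0 < ε) {k : ℕ}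
    (hk : k < n) (hd : 0 < dist (sideMidpoint n c w k) c) :
    0 < orient 1 (offsetLabel n c w ε (sideStart n k)) (offsetLabel n c w ε (2 * k + 1))
      (offsetLabel n c w ε (2 * k)) := by
  have hn0 : (0 : ℝ) < n := by norm_cast; omega
  have hc : 0 < orient 1 (vertex n c w k) (vertex n c w (k + 1)) c := by
    rw [orient_vertex_center]
    refine mul_pos (re_sq_add_im_sq_pos hw) (Real.sin_pos_of_pos_of_lt_pi ?_ ?_)
    · push_cast
      have : 0 < Real.pi / n := div_pos Real.pi_pos hn0
      have e : 2 * (Real.pi * (k + 1) / n) - 2 * (Real.pi * k / n) = 2 * (Real.pi / n) := by ring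
      rw [e]
      linarith
    · push_cast
      have e : 2 * (Real.pi * (k + 1) / n) - 2 * (Real.pi * k / n) = (2 * Real.pi) / n := by ring
      rw [e, div_lt_iff₀ hn0]
      have : (3 : ℝ) ≤ n := by exact_mod_cast hn
      nlinarith [Real.pi_pos]
  rw [offsetLabel_sideStart hn c w ε hk, offsetLabel, if_neg (by omega), offsetLabel,
    if_pos (by omega), show (2 * k + 1) / 2 + 1 = k + 1 by omega, show 2 * k / 2 = k by omega,
    innerPoint, orient_lineMap, sideMidpoint, midpoint, orient_lineMap, orient_self_left,
    orient_self_right]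
  have := mul_pos (div_pos hε hd) hc
  rw [sideMidpoint, midpoint] at this
  linarith

open Filter Topology in
theorem eventually_doubleCircleLabels (hn : 3 ≤ n) (c : ℂ) {w : ℂ} (hw : w ≠ 0)
    (hd : ∀ k < n, 0 < dist (sideMidpoint n c w k) c) :
    ∀ᶠ ε in 𝓝[>] (0 : ℝ), DoubleCircleLabels n (offsetLabel n c w ε) := by
  have hev : ∀ᶠ ε in 𝓝 (0 : ℝ), ∀ t ∈ Finset.range (2 * n) ×ˢ Finset.range (2 * n) ×ˢ
      Finset.range (2 * n), t.1 < t.2.1 → t.2.1 < t.2.2 →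
      ¬ (t.1 % 2 = 1 ∧ t.2.1 = t.1 + 1 ∧ t.2.2 = t.1 + 2) →
      ¬ (t.1 = 0 ∧ t.2.1 = 1 ∧ t.2.2 = 2 * n - 1) →
      0 < triOrient 1 (offsetLabel n c w ε) t := by
    rw [eventually_all_finset]
    intro t ht
    simp only [Finset.mem_product, Finset.mem_range] at ht
    simp only [eventually_imp_distrib_left]
    intro h1 h2 h3 h4
    have hc : Continuous fun ε => triOrient 1 (offsetLabel n c w ε) t :=
      continuous_orient.comp ((continuous_offsetLabel _ _ _ _).prodMk
        ((continuous_offsetLabel _ _ _ _).prodMk (continuous_offsetLabel _ _ _ _)))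
    exact hc.continuousAt.eventually
      (lt_mem_nhds (orient_offsetLabel_zero hn c hw h1 h2 ht.2.2 h3 h4))
  filter_upwards [self_mem_nhdsWithin, hev.filter_mono nhdsWithin_le_nhds] with ε hε h
  refine ⟨hn, fun i j k hij hjk hk h1 h2 => ?_, fun k hk => orient_pocket hn c hw hε hk (hd k hk)⟩
  exact h (i, j, k) (by simp; omega) hij hjk h1 h2

theorem mem_offsetPolygon (hn : 3 ≤ n) (c w : ℂ) (ε : ℝ) (z : ℂ) :
    z ∈ offsetPolygon n c w ε ↔ ∃ i < 2 * n, offsetLabel n c w ε i = z := by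
  simp only [offsetPolygon, Finset.mem_union, Finset.mem_image, Finset.mem_range]
  constructor
  · rintro (⟨k, hk, rfl⟩ | ⟨k, hk, rfl⟩)
    · exact ⟨_, sideStart_lt hn hk, offsetLabel_sideStart hn c w ε hk⟩
    · exact ⟨2 * k, by omega, by simp [offsetLabel]⟩
  · rintro ⟨i, hi, rfl⟩
    unfold offsetLabel
    split_ifs with hp
    · exact Or.inr ⟨i / 2, by omega, rfl⟩
    · by_cases h : i / 2 + 1 = n
      · exact Or.inl ⟨0, by omega, by rw [h, vertex_self hn]⟩
      · exact Or.inl ⟨i / 2 + 1, by omega, rfl⟩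

theorem ccw_iff {p q r : ℂ} : CCW p q r ↔ 0 < orient 1 p q r := by
  simp [CCW, orient]

theorem IsDoubleCircle.exists_labels {P : Finset ℂ} (hP : IsDoubleCircle P) :
    ∃ n p, DoubleCircleLabels n p ∧ ∀ z, z ∈ P ↔ ∃ i < 2 * n, p i = z := by
  obtain ⟨n, c, w, ε, hn, hw, hε, hdist, hord, rfl⟩ := hP
  obtain ⟨ε', hL, hε0, hε1⟩ := ((eventually_doubleCircleLabels hn c hw
    fun k hk => hε.trans_le (hdist k hk)).and (Ioo_mem_nhdsGT hε)).exists
  obtain ⟨f, hf, hccw⟩ := hord ε' hε0 hε1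
  have hex : ∀ i, ∃ z, i < 2 * n → z ∈ offsetPolygon n c w ε ∧ f z = offsetLabel n c w ε' i := by
    intro i
    by_cases hi : i < 2 * n
    · obtain ⟨z, hz, hfz⟩ := hf.surjOn
        (Finset.mem_coe.2 ((mem_offsetPolygon hn c w ε' _).2 ⟨i, hi, rfl⟩))
      exact ⟨z, fun _ => ⟨hz, hfz⟩⟩
    · exact ⟨0, fun h => absurd h hi⟩
  choose p hp using hex
  have horient : ∀ i j k, i < 2 * n → j < 2 * n → k < 2 * n →
      0 < orient 1 (offsetLabel n c w ε' i) (offsetLabel n c w ε' j) (offsetLabel n c w ε' k) →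
      0 < orient 1 (p i) (p j) (p k) := by
    intro i j k hi hj hk h
    rw [← (hp i hi).2, ← (hp j hj).2, ← (hp k hk).2] at h
    exact ccw_iff.1 ((hccw _ (hp i hi).1 _ (hp j hj).1 _ (hp k hk).1).2 (ccw_iff.2 h))
  refine ⟨n, p, ⟨hn, fun i j k hij hjk hk h1 h2 => ?_, fun k hk => ?_⟩, fun z => ⟨fun hz => ?_, ?_⟩⟩
  · exact horient i j k (by omega) (by omega) hk (hL.pos i j k hij hjk hk h1 h2)
  · exact horient _ _ _ (sideStart_lt hn hk) (by omega) (by omega) (hL.pocket k hk)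
  · obtain ⟨i, hi, hiz⟩ := (mem_offsetPolygon hn c w ε' _).1 (Finset.mem_coe.1 (hf.mapsTo hz))
    exact ⟨i, hi, hf.injOn (hp i hi).1 hz ((hp i hi).2.trans hiz)⟩
  · rintro ⟨i, hi, rfl⟩
    exact (hp i hi).1

namespace DoubleCircleLabels

variable {p : ℕ → ℂ}

theorem framed (h : DoubleCircleLabels n p) : IsFramed 1 n p := by
  have hn := h.three_le
  intro k hk j hj hj1 hj2
  by_cases hj3 : j = 2 * k
  · rw [hj3]
    exact h.pocket k hk
  rcases k with _ | k
  · rw [sideStart_zero] at *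
    rw [← orient_rot]
    exact h.pos _ _ _ (by omega) (by omega) (by omega) (by omega) (by omega)
  · rw [sideStart_succ] at *
    rcases lt_or_ge j (2 * k + 1) with hlt | hge
    · rw [orient_rot]
      exact h.pos _ _ _ (by omega) (by omega) (by omega) (by omega) (by omega)
    · exact h.pos _ _ _ (by omega) (by omega) (by omega) (by omega) (by omega)

theorem orient_ne_zero (h : DoubleCircleLabels n p) {a b c : ℕ} (hab : a < b) (hbc : b < c)
    (hc : c < 2 * n) : orient 1 (p a) (p b) (p c) ≠ 0 := by
  have hn := h.three_le
  by_cases h1 : a % 2 = 1 ∧ b = a + 1 ∧ c = a + 2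
  · obtain ⟨k, rfl⟩ : ∃ k, a = 2 * k + 1 := ⟨a / 2, by omega⟩
    have := h.pocket (k + 1) (by omega)
    rw [sideStart_succ] at this
    rw [h1.2.1, h1.2.2, ← orient_rot, orient_swap]
    exact neg_ne_zero.2 (by rw [orient_rot]; exact this.ne')
  by_cases h2 : a = 0 ∧ b = 1 ∧ c = 2 * n - 1
  · have := h.pocket 0 (by omega)
    rw [sideStart_zero] at this
    rw [h2.1, h2.2.1, h2.2.2, ← orient_rot, orient_swap]
    exact neg_ne_zero.2 this.ne'
  · exact (h.pos a b c hab hbc hc h1 h2).ne'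

theorem generic (h : DoubleCircleLabels n p) : LabelsGeneric 1 n p := by
  intro a ha b hb c hc hab hbc hca
  rcases lt_or_gt_of_ne hab with h1 | h1 <;> rcases lt_or_gt_of_ne hbc with h2 | h2 <;>
    rcases lt_or_gt_of_ne hca with h3 | h3
  · omega
  · exact h.orient_ne_zero h1 h2 hc
  · rw [orient_rot (p c) (p a) (p b)]
    exact h.orient_ne_zero h3 h1 hb
  · rw [orient_swap_right (p a) (p c) (p b)]
    exact neg_ne_zero.2 (h.orient_ne_zero h3 h2 hb)
  · rw [← orient_rot (p a) (p b) (p c)]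
    exact h.orient_ne_zero h2 h3 ha
  · rw [orient_swap (p b) (p a) (p c)]
    exact neg_ne_zero.2 (h.orient_ne_zero h1 h3 hc)
  · rw [orient_rot (p c) (p a) (p b), orient_swap_right (p c) (p b) (p a)]
    exact neg_ne_zero.2 (h.orient_ne_zero h2 h1 ha)
  · omega

end DoubleCircleLabels

/-! ### Vertices and edges of convex hulls -/

theorem mem_of_orient_nonneg {K : Set ℂ} (hK : Convex ℝ K) {x u v w : ℂ} (hu : u ∈ K) (hv : v ∈ K)
    (hw : w ∈ K) (h : 0 < orient s u v w) (h1 : 0 ≤ orient s x u v) (h2 : 0 ≤ orient s x v w)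
    (h3 : 0 ≤ orient s x w u) : x ∈ K := by
  have hsum := orient_add_orient (s := s) x u v w
  have hre : orient s u v w * x.re = orient s x v w * u.re + orient s x w u * v.re +
      orient s x u v * w.re := by unfold orient; ring
  have him : orient s u v w * x.im = orient s x v w * u.im + orient s x w u * v.im +
      orient s x u v * w.im := by unfold orient; ring
  have hmem := hK.sum_mem (t := Finset.univ) (w := ![orient s x v w / orient s u v w,
    orient s x w u / orient s u v w, orient s x u v / orient s u v w]) (z := ![u, v, w])
    (by
      intro i _
      fin_cases i
      · exact div_nonneg h2 h.le
      · exact div_nonneg h3 h.le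
      · exact div_nonneg h1 h.le)
    (by
      simp only [Fin.sum_univ_three, Matrix.cons_val]
      rw [← add_div, ← add_div, hsum, div_self h.ne'])
    (by
      intro i _
      fin_cases i
      · exact hu
      · exact hv
      · exact hw)
  convert hmem
  simp only [Fin.sum_univ_three, Matrix.cons_val]
  apply Complex.ext
  · simp only [Complex.add_re, Complex.real_smul, Complex.mul_re, Complex.ofReal_re,
      Complex.ofReal_im]
    field_simp
    linarith
  · simp only [Complex.add_im, Complex.real_smul, Complex.mul_im, Complex.ofReal_re,
      Complex.ofReal_im]
    field_simp
    linarith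

/-- A point in the interior of a triangle is not an extreme point. -/
theorem not_mem_extremePoints_of_inTri {K : Set ℂ} (hK : Convex ℝ K) {x u v w : ℂ} (hu : u ∈ K)
    (hv : v ∈ K) (hw : w ∈ K) (hx : InTri s x u v w) : x ∉ K.extremePoints ℝ := by
  intro hext
  have hpos : 0 < orient s u v w := by
    have := orient_add_orient (s := s) x u v w
    linarith [hx.1, hx.2.1, hx.2.2]
  obtain ⟨δ, ⟨h1, h2⟩, hδ⟩ := (((eventually_inTri_of_inTri (y := u) hx).and
    (eventually_inTri_of_inTri (y := x - (u - x)) hx)).and self_mem_nhdsWithin).exists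
  have m1 := mem_of_orient_nonneg hK hu hv hw hpos h1.1.le h1.2.1.le h1.2.2.le
  have m2 := mem_of_orient_nonneg hK hu hv hw hpos h2.1.le h2.2.1.le h2.2.2.le
  have hseg : x ∈ openSegment ℝ (AffineMap.lineMap x u δ) (AffineMap.lineMap x (x - (u - x)) δ) := by
    refine ⟨1 / 2, 1 / 2, by norm_num, by norm_num, by norm_num, ?_⟩
    simp only [AffineMap.lineMap_apply, vsub_eq_sub, vadd_eq_add, Complex.real_smul]
    push_cast
    ring
  have := (mem_extremePoints.1 hext).2 _ m1 _ m2 hseg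
  rw [AffineMap.lineMap_eq_left_iff] at this
  rcases this.1 with h | h
  · have := hx.1
    rw [h, orient_self] at this
    exact lt_irrefl _ this
  · exact (Set.mem_Ioi.1 hδ).ne' h

theorem orient_nonneg_of_mem_convexHull {Q : Finset ℂ} {a b : ℂ}
    (h : ∀ z ∈ Q, 0 ≤ orient s a b z) {x : ℂ} (hx : x ∈ convexHull ℝ (Q : Set ℂ)) :
    0 ≤ orient s a b x := by
  have hconv : Convex ℝ {z | 0 ≤ orient s a b z} := by
    rw [convex_iff_segment_subset]
    intro y hy z hz x hx
    obtain ⟨r, h0, h1, rfl⟩ := exists_lineMap_of_mem_segment hx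
    rw [Set.mem_ofPred_eq, orient_lineMap]
    exact add_nonneg (mul_nonneg (by linarith) hy) (mul_nonneg h0 hz)
  exact convexHull_min (fun z hz => h z hz) hconv hx

theorem orient_eq_zero_of_mem_openSegment {a b x y z : ℂ} (hy : 0 ≤ orient s a b y)
    (hz : 0 ≤ orient s a b z) (hx : x ∈ openSegment ℝ y z) (h0 : orient s a b x = 0) :
    orient s a b y = 0 ∧ orient s a b z = 0 := by
  rw [openSegment_eq_image_lineMap] at hx
  obtain ⟨r, ⟨hr0, hr1⟩, rfl⟩ := hx
  rw [orient_lineMap] at h0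
  have h1 := mul_nonneg (sub_pos.2 hr1).le hy
  have h2 := mul_nonneg hr0.le hz
  refine ⟨?_, ?_⟩
  · have : (1 - r) * orient s a b y = 0 := by linarith
    exact (mul_eq_zero.1 this).resolve_left (sub_pos.2 hr1).ne'
  · have : r * orient s a b z = 0 := by linarith
    exact (mul_eq_zero.1 this).resolve_left hr0.ne'

/-- Two lines that are not parallel meet in one point. -/
theorem eq_of_orient_eq_zero {a b c x : ℂ} (h : orient s a b c ≠ 0) (h1 : orient s a b x = 0)
    (h2 : orient s b c x = 0) : x = b := by
  have hre : orient s a b c * (x.re - b.re) =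
      orient s a b x * (c.re - b.re) + orient s b c x * (a.re - b.re) := by unfold orient; ring
  have him : orient s a b c * (x.im - b.im) =
      orient s a b x * (c.im - b.im) + orient s b c x * (a.im - b.im) := by unfold orient; ring
  rw [h1, h2] at hre him
  simp only [zero_mul, add_zero, mul_eq_zero, h, false_or] at hre him
  exact Complex.ext (by linarith) (by linarith)

theorem IsFramed.orient_nonneg (H : IsFramed s n q) {Q : Finset ℂ}
    (hQ : ∀ z, z ∈ Q ↔ ∃ i < 2 * n, q i = z) {k : ℕ} (hk : k < n) {x : ℂ}
    (hx : x ∈ convexHull ℝ (Q : Set ℂ)) :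
    0 ≤ orient s (q (sideStart n k)) (q (2 * k + 1)) x := by
  refine orient_nonneg_of_mem_convexHull (fun z hz => ?_) hx
  obtain ⟨i, hi, rfl⟩ := (hQ z).1 hz
  exact H.nonneg hk hi

/-- The two sides at a vertex of the hull. -/
theorem exists_sides (hn : 3 ≤ n) {i : ℕ} (hi : i < 2 * n) (hodd : i % 2 = 1) :
    ∃ j < n, ∃ m < n, i = 2 * j + 1 ∧ i = sideStart n m ∧ 2 * m + 1 ≠ sideStart n j ∧
      2 * m + 1 ≠ 2 * j + 1 := by
  obtain ⟨j, rfl⟩ : ∃ j, i = 2 * j + 1 := ⟨i / 2, by omega⟩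
  by_cases h : j + 1 < n
  · refine ⟨j, by omega, j + 1, h, rfl, (sideStart_succ j).symm, ?_, by omega⟩
    unfold sideStart; split_ifs <;> omega
  · refine ⟨j, by omega, 0, by omega, rfl, by rw [sideStart_zero]; omega, ?_, by omega⟩
    unfold sideStart; split_ifs <;> omega

theorem IsFramed.mem_hullVertices (hn : 3 ≤ n) (H : IsFramed s n q) {Q : Finset ℂ}
    (hQ : ∀ z, z ∈ Q ↔ ∃ i < 2 * n, q i = z) {i : ℕ} (hi : i < 2 * n) (hodd : i % 2 = 1) :
    q i ∈ hullVertices Q := by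
  refine mem_extremePoints.2 ⟨subset_convexHull ℝ _ ((hQ _).2 ⟨i, hi, rfl⟩), ?_⟩
  obtain ⟨j, hj, m, hm, hij, him, h1, h2⟩ := exists_sides hn hi hodd
  have hpos := H j hj (2 * m + 1) (by omega) h1 h2
  intro x hx y hy hxy
  have e1 := orient_eq_zero_of_mem_openSegment (H.orient_nonneg hQ hj hx)
    (H.orient_nonneg hQ hj hy) hxy (by rw [hij, orient_self_right])
  have e2 := orient_eq_zero_of_mem_openSegment (H.orient_nonneg hQ hm hx)
    (H.orient_nonneg hQ hm hy) hxy (by rw [him, orient_self_left])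
  rw [← him, hij] at e2
  rw [hij]
  exact ⟨eq_of_orient_eq_zero hpos.ne' e1.1 e2.1, eq_of_orient_eq_zero hpos.ne' e1.2 e2.2⟩

theorem IsFramed.isHullEdge (hn : 3 ≤ n) (H : IsFramed s n q) (hgen : LabelsGeneric s n q)
    {Q : Finset ℂ} (hQ : ∀ z, z ∈ Q ↔ ∃ i < 2 * n, q i = z) {k : ℕ} (hk : k < n) :
    IsHullEdge Q (q (sideStart n k)) (q (2 * k + 1)) := by
  have hlt := sideStart_lt hn hk
  refine ⟨H.mem_hullVertices hn hQ hlt (sideStart_odd hn k),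
    H.mem_hullVertices hn hQ (by omega) (by omega),
    fun h => sideStart_ne hn k (hgen.injOn hn hlt (by omega) h), ?_⟩
  intro x hx
  have hmem : ∀ i < 2 * n, q i ∈ convexHull ℝ (Q : Set ℂ) := fun i hi =>
    subset_convexHull ℝ _ ((hQ _).2 ⟨i, hi, rfl⟩)
  refine ⟨subset_closure ((convex_convexHull ℝ _).segment_subset (hmem _ hlt)
    (hmem _ (by omega)) hx), fun hint => ?_⟩
  -- A point slightly behind `x`, as seen from the inner point, would be in the hull.
  have hin := H k hk (2 * k) (by omega) (by have := sideStart_odd hn k; omega) (by omega)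
  have hx0 : orient s (q (sideStart n k)) (q (2 * k + 1)) x = 0 := by
    obtain ⟨r, -, -, rfl⟩ := exists_lineMap_of_mem_segment hx
    rw [orient_lineMap, orient_self_left, orient_self_right]
    ring
  have hcont : Continuous fun δ : ℝ => AffineMap.lineMap x (q (2 * k)) (-δ) :=
    AffineMap.lineMap_continuous.comp continuous_neg
  have hev : ∀ᶠ δ : ℝ in nhds 0, AffineMap.lineMap x (q (2 * k)) (-δ) ∈
      interior (convexHull ℝ (Q : Set ℂ)) :=
    hcont.continuousAt.eventually (isOpen_interior.mem_nhds (by simpa using hint))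
  obtain ⟨δ, h1, h2⟩ := ((hev.filter_mono nhdsWithin_le_nhds).and
    (self_mem_nhdsWithin (s := Set.Ioi (0 : ℝ)))).exists
  have h3 := H.orient_nonneg hQ hk (interior_subset h1)
  rw [orient_lineMap, hx0] at h3
  have := mul_pos (Set.mem_Ioi.1 h2) hin
  linarith

theorem DoubleCircleLabels.mem_hullVertices_iff {p : ℕ → ℂ} (h : DoubleCircleLabels n p)
    {P : Finset ℂ} (hP : ∀ z, z ∈ P ↔ ∃ i < 2 * n, p i = z) {z : ℂ} :
    z ∈ hullVertices P ↔ ∃ i < 2 * n, i % 2 = 1 ∧ p i = z := by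
  have hn := h.three_le
  refine ⟨fun hz => ?_, ?_⟩
  · obtain ⟨i, hi, rfl⟩ := (hP z).1 (extremePoints_convexHull_subset hz)
    refine ⟨i, hi, ?_, rfl⟩
    by_contra heven
    obtain ⟨k, rfl⟩ : ∃ k, i = 2 * k := ⟨i / 2, by omega⟩
    have hmem : ∀ i < 2 * n, p i ∈ convexHull ℝ (P : Set ℂ) := fun i hi =>
      subset_convexHull ℝ _ ((hP _).2 ⟨i, hi, rfl⟩)
    -- The inner point lies in the triangle of its side and a third vertex `m`.
    obtain ⟨m, hm, h1, h2⟩ : ∃ m < 2 * n, 0 < orient 1 (p (2 * k)) (p (2 * k + 1)) (p m) ∧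
        0 < orient 1 (p (2 * k)) (p m) (p (sideStart n k)) := by
      by_cases h0 : k = 0
      · subst h0
        rw [sideStart_zero]
        exact ⟨3, by omega, h.pos _ _ _ (by omega) (by omega) (by omega) (by omega) (by omega),
          h.pos _ _ _ (by omega) (by omega) (by omega) (by omega) (by omega)⟩
      obtain ⟨l, rfl⟩ : ∃ l, k = l + 1 := ⟨k - 1, by omega⟩
      rw [sideStart_succ]
      by_cases h1 : l + 2 = n
      · refine ⟨1, by omega, ?_, ?_⟩
        · rw [orient_rot (p 1)]
          exact h.pos _ _ _ (by omega) (by omega) (by omega) (by omega) (by omega)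
        · rw [← orient_rot]
          exact h.pos _ _ _ (by omega) (by omega) (by omega) (by omega) (by omega)
      · refine ⟨2 * n - 1, by omega, ?_, ?_⟩
        · exact h.pos _ _ _ (by omega) (by omega) (by omega) (by omega) (by omega)
        · rw [orient_rot (p (2 * l + 1))]
          exact h.pos _ _ _ (by omega) (by omega) (by omega) (by omega) (by omega)
    refine not_mem_extremePoints_of_inTri (convex_convexHull ℝ _)
      (hmem _ (sideStart_lt hn (by omega : k < n))) (hmem (2 * k + 1) (by omega)) (hmem m hm)
      ⟨?_, h1, h2⟩ hz
    rw [← orient_rot]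
    exact h.pocket k (by omega)
  · rintro ⟨i, hi, hodd, rfl⟩
    exact h.framed.mem_hullVertices hn hP hi hodd

theorem GeneralPosition.orient_ne_zero {Q : Finset ℂ} (hQ : GeneralPosition Q) (hs : s ≠ 0)
    {x y z : ℂ} (hx : x ∈ Q) (hy : y ∈ Q) (hz : z ∈ Q) (hxy : x ≠ y) (hyz : y ≠ z) (hzx : z ≠ x) :
    orient s x y z ≠ 0 := fun h =>
  hQ x hx y hy z hz hxy hzx.symm hyz (collinear_of_orient_eq_zero hs h)

/-- No two points of `Q` lie strictly on different sides of an edge of the convex hull of `Q`. -/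
theorem IsHullEdge.not_separated {Q : Finset ℂ} {a b x y : ℂ} (h : IsHullEdge Q a b) (hx : x ∈ Q)
    (hy : y ∈ Q) (hax : 0 < orient 1 a b x) (hay : orient 1 a b y < 0) : False := by
  obtain ⟨ha, hb, -, hfr⟩ := h
  have hconv := convex_convexHull ℝ (Q : Set ℂ)
  have hxK := subset_convexHull ℝ (Q : Set ℂ) hx
  have hyK := subset_convexHull ℝ (Q : Set ℂ) hy
  have haK := extremePoints_subset ha
  have hbK := extremePoints_subset hb
  set m := AffineMap.lineMap a b (1 / 2 : ℝ) with hm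
  have hmseg : m ∈ segment ℝ a b := by
    rw [segment_eq_image_lineMap]
    exact ⟨1 / 2, by norm_num, rfl⟩
  refine (hfr hmseg).2 (mem_interior_iff_mem_nhds.2 ?_)
  have hc : ∀ u v : ℂ, ContinuousAt (fun z => orient 1 z u v) m := fun u v =>
    (continuous_orient.comp (continuous_id.prodMk
      (continuous_const.prodMk continuous_const))).continuousAt
  have hay' : 0 < orient 1 b a y := by rw [orient_swap]; linarith
  -- The midpoint `m` of the edge is interior to the union of the triangles `a b x` and `b a y`.
  have e1 : 0 < orient 1 m b x := by rw [hm, orient_lineMap_left]; linarith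
  have e2 : 0 < orient 1 m x a := by
    rw [orient_rot a m x, hm, orient_lineMap_middle]; linarith
  have e3 : 0 < orient 1 m a y := by
    rw [hm, ← AffineMap.lineMap_apply_one_sub, orient_lineMap_left]; linarith
  have e4 : 0 < orient 1 m y b := by
    rw [orient_rot b m y, hm, ← AffineMap.lineMap_apply_one_sub, orient_lineMap_middle]; linarith
  filter_upwards [(hc b x).eventually (lt_mem_nhds e1), (hc x a).eventually (lt_mem_nhds e2),
    (hc a y).eventually (lt_mem_nhds e3), (hc y b).eventually (lt_mem_nhds e4)] with z f1 f2 f3 f4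
  rcases le_or_gt 0 (orient 1 z a b) with hz | hz
  · exact mem_of_orient_nonneg hconv haK hbK hxK hax hz f1.le f2.le
  · refine mem_of_orient_nonneg hconv hbK haK hyK hay' ?_ f3.le f4.le
    rw [orient_swap_right]
    linarith

theorem IsHullEdge.same_side {Q : Finset ℂ} (hQ : GeneralPosition Q) {a b x y : ℂ}
    (h : IsHullEdge Q a b) (hx : x ∈ Q) (hy : y ∈ Q) (hxa : x ≠ a) (hxb : x ≠ b) (hya : y ≠ a)
    (hyb : y ≠ b) : 0 < orient 1 a b x * orient 1 a b y := by
  have haQ : a ∈ Q := extremePoints_convexHull_subset h.1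
  have hbQ : b ∈ Q := extremePoints_convexHull_subset h.2.1
  have h1 := hQ.orient_ne_zero one_ne_zero haQ hbQ hx h.2.2.1 hxb.symm hxa
  have h2 := hQ.orient_ne_zero one_ne_zero haQ hbQ hy h.2.2.1 hyb.symm hya
  rcases lt_or_gt_of_ne h1 with h1 | h1 <;> rcases lt_or_gt_of_ne h2 with h2 | h2
  · exact mul_pos_of_neg_of_neg h1 h2
  · exact (h.not_separated hy hx h2 h1).elim
  · exact (h.not_separated hx hy h1 h2).elim
  · exact mul_pos h1 h2

/-- If the closed polygon through the odd labels consists of edges of the convex hull of `Q`, then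
all points of `Q` lie on the same side, left or right, of all these edges. -/
theorem exists_orientation (hn : 3 ≤ n) {Q : Finset ℂ} (hQ : GeneralPosition Q) {v : ℕ → ℂ}
    (hv : ∀ i < 2 * n, i % 2 = 1 → v i ∈ Q)
    (hinj : ∀ i < 2 * n, ∀ j < 2 * n, i % 2 = 1 → j % 2 = 1 → v i = v j → i = j)
    (hedge : ∀ k < n, IsHullEdge Q (v (sideStart n k)) (v (2 * k + 1))) :
    ∃ s ≠ 0, ∀ k < n, ∀ z ∈ Q, z ≠ v (sideStart n k) → z ≠ v (2 * k + 1) →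
      0 < orient s (v (sideStart n k)) (v (2 * k + 1)) z := by
  have hne : ∀ i < 2 * n, ∀ j < 2 * n, i % 2 = 1 → j % 2 = 1 → i ≠ j → v i ≠ v j :=
    fun i hi j hj h1 h2 hij h => hij (hinj i hi j hj h1 h2 h)
  have hss := fun k (hk : k < n) => sideStart_lt hn hk
  have hso := fun k => sideStart_odd hn k
  refine ⟨orient 1 (v (sideStart n 0)) (v 1) (v 3), ?_, ?_⟩
  · have h0 := hss 0 (by omega)
    refine hQ.orient_ne_zero one_ne_zero (hv _ h0 (hso 0)) (hv 1 (by omega) rfl)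
      (hv 3 (by omega) rfl) (hne _ h0 _ (by omega) (hso 0) rfl ?_)
      (hne _ (by omega) _ (by omega) rfl rfl (by omega)) (hne _ (by omega) _ h0 rfl (hso 0) ?_)
    all_goals rw [sideStart_zero]; omega
  · intro k
    induction k with
    | zero =>
      intro hk z hz h1 h2
      rw [orient_eq_mul]
      have h0 := hss 0 (by omega)
      refine (hedge 0 hk).same_side hQ (hv 3 (by omega) rfl) hz
        (hne _ (by omega) _ h0 rfl (hso 0) ?_) (hne _ (by omega) _ (by omega) rfl rfl (by omega))
        h1 h2
      rw [sideStart_zero]; omega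
    | succ k ih =>
      intro hk z hz h1 h2
      have h0 := hss k (by omega)
      have hss1 : sideStart n k ≠ 2 * (k + 1) + 1 := by unfold sideStart; split_ifs <;> omega
      have h3 := ih (by omega) (v (2 * (k + 1) + 1)) (hv _ (by omega) (by omega))
        (hne _ (by omega) _ h0 (by omega) (hso k) hss1.symm)
        (hne _ (by omega) _ (by omega) (by omega) (by omega) (by omega))
      have h4 := (hedge (k + 1) hk).same_side hQ (hv _ h0 (hso k)) hz
        (by
          rw [sideStart_succ]
          exact hne _ h0 _ (by omega) (hso k) (by omega) (sideStart_ne hn k))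
        (hne _ h0 _ (by omega) (hso k) (by omega) hss1) h1 h2
      rw [sideStart_succ] at h4 ⊢
      rw [orient_eq_mul] at h3 ⊢
      rw [orient_rot] at h4
      set X := orient 1 (v (sideStart n k)) (v (2 * k + 1)) (v (2 * (k + 1) + 1))
      have h5 := mul_pos h3 h4
      have hX : 0 < X ^ 2 := by
        have : X ≠ 0 := by
          intro h
          rw [h] at h4
          simp at h4
        positivity
      refine pos_of_mul_pos_left (b := X ^ 2) ?_ hX.le
      linarith

/-! ### Matching inner points with sides -/

/-- A permutation that minimises `∏ i, g i (σ i)` has this property, since composing it with a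
transposition does not decrease the product. -/
theorem exists_perm_swap_le {m : ℕ} (g : Fin m → Fin m → ℝ) (hg : ∀ i j, 0 < g i j) :
    ∃ σ : Equiv.Perm (Fin m), ∀ i j, i ≠ j →
      g i (σ i) * g j (σ j) ≤ g i (σ j) * g j (σ i) := by
  obtain ⟨σ, hσ⟩ := Finite.exists_min fun σ : Equiv.Perm (Fin m) => ∏ i, g i (σ i)
  refine ⟨σ, fun i j hij => ?_⟩
  have h := hσ (σ * Equiv.swap i j)
  have hj : j ∈ Finset.univ.erase i := Finset.mem_erase.2 ⟨hij.symm, Finset.mem_univ _⟩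
  have hsplit : ∀ τ : Equiv.Perm (Fin m), ∏ k, g k (τ k) =
      g i (τ i) * g j (τ j) * ∏ k ∈ (Finset.univ.erase i).erase j, g k (τ k) := by
    intro τ
    rw [mul_assoc, Finset.mul_prod_erase _ (fun k => g k (τ k)) hj,
      Finset.mul_prod_erase _ (fun k => g k (τ k)) (Finset.mem_univ i)]
  simp only [hsplit] at h
  have hrest : ∏ k ∈ (Finset.univ.erase i).erase j, g k ((σ * Equiv.swap i j) k) =
      ∏ k ∈ (Finset.univ.erase i).erase j, g k (σ k) := by
    refine Finset.prod_congr rfl fun k hk => ?_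
    simp only [Finset.mem_erase, Finset.mem_univ, and_true] at hk
    rw [Equiv.Perm.mul_apply, Equiv.swap_apply_of_ne_of_ne hk.2 hk.1]
  rw [hrest, Equiv.Perm.mul_apply, Equiv.Perm.mul_apply, Equiv.swap_apply_left,
    Equiv.swap_apply_right] at h
  exact le_of_mul_le_mul_right h (Finset.prod_pos fun k _ => hg _ _)

/-- The positions of the vertices of the hull of `Q` can be completed to a labelling of `Q` that has
a positively oriented triangulation. -/
theorem exists_posTri (hn : 3 ≤ n) {Q : Finset ℂ} (hQ : GeneralPosition Q) (hcard : Q.card = 2 * n)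
    {v : ℕ → ℂ} (hv : ∀ i < 2 * n, i % 2 = 1 → v i ∈ Q)
    (hinj : ∀ i < 2 * n, ∀ j < 2 * n, i % 2 = 1 → j % 2 = 1 → v i = v j → i = j)
    (hedge : ∀ k < n, IsHullEdge Q (v (sideStart n k)) (v (2 * k + 1))) :
    ∃ s q S, PosTri s n q S ∧ (∀ z, z ∈ Q ↔ ∃ i < 2 * n, q i = z) ∧
      ∀ i, i % 2 = 1 → q i = v i := by
  classical
  obtain ⟨s, hs, hpos⟩ := exists_orientation hn hQ hv hinj hedge
  let V : Finset ℂ := (Finset.range n).image fun k => v (2 * k + 1)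
  have hVQ : V ⊆ Q := by
    intro z hz
    obtain ⟨k, hk, rfl⟩ := Finset.mem_image.1 hz
    have := Finset.mem_range.1 hk
    exact hv _ (by omega) (by omega)
  have hVcard : V.card = n := by
    rw [Finset.card_image_of_injOn, Finset.card_range]
    intro i hi j hj hij
    simp only [Finset.coe_range, Set.mem_Iio] at hi hj
    have := hinj _ (by omega) _ (by omega) (by omega) (by omega) hij
    omega
  have hVmem : ∀ i < 2 * n, i % 2 = 1 → v i ∈ V := by
    intro i hi hodd
    exact Finset.mem_image.2 ⟨i / 2, Finset.mem_range.2 (by omega), by congr 1; omega⟩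
  have hIcard : (Q \ V).card = n := by
    rw [Finset.card_sdiff_of_subset hVQ, hcard, hVcard]
    omega
  let e := (Finset.equivFinOfCardEq hIcard).symm
  have heV : ∀ i, (e i : ℂ) ∉ V := fun i => (Finset.mem_sdiff.1 (e i).2).2
  have heQ : ∀ i, (e i : ℂ) ∈ Q := fun i => (Finset.mem_sdiff.1 (e i).2).1
  have hev : ∀ i j, j < 2 * n → j % 2 = 1 → (e i : ℂ) ≠ v j := fun i j hj hodd h =>
    heV i (h ▸ hVmem j hj hodd)
  obtain ⟨σ, hσ⟩ := exists_perm_swap_le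
    (fun i j : Fin n => orient s (v (sideStart n i)) (v (2 * i + 1)) (e j)) fun i j =>
      hpos i i.2 _ (heQ j) (hev j _ (sideStart_lt hn i.2) (sideStart_odd hn i))
        (hev j _ (by omega) (by omega))
  let q : ℕ → ℂ := fun i =>
    if i % 2 = 0 then if h : i / 2 < n then (e (σ ⟨i / 2, h⟩) : ℂ) else 0 else v i
  have hqodd : ∀ i, i % 2 = 1 → q i = v i := fun i hi => by simp [q, hi]
  have hqeven : ∀ k (hk : k < n), q (2 * k) = e (σ ⟨k, hk⟩) := fun k hk => by simp [q, hk]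
  have hqQ : ∀ i < 2 * n, q i ∈ Q := by
    intro i hi
    rcases Nat.mod_two_eq_zero_or_one i with hp | hp
    · obtain ⟨k, rfl⟩ : ∃ k, i = 2 * k := ⟨i / 2, by omega⟩
      rw [hqeven k (by omega)]
      exact heQ _
    · rw [hqodd i hp]
      exact hv i hi hp
  have hqinj : ∀ i < 2 * n, ∀ j < 2 * n, q i = q j → i = j := by
    intro i hi j hj h
    rcases Nat.mod_two_eq_zero_or_one i with hp | hp <;>
      rcases Nat.mod_two_eq_zero_or_one j with hp' | hp'
    · obtain ⟨k, rfl⟩ : ∃ k, i = 2 * k := ⟨i / 2, by omega⟩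
      obtain ⟨l, rfl⟩ : ∃ l, j = 2 * l := ⟨j / 2, by omega⟩
      rw [hqeven k (by omega), hqeven l (by omega)] at h
      have := σ.injective (e.injective (Subtype.ext h))
      simp only [Fin.mk.injEq] at this
      omega
    · obtain ⟨k, rfl⟩ : ∃ k, i = 2 * k := ⟨i / 2, by omega⟩
      rw [hqeven k (by omega), hqodd j hp'] at h
      exact absurd h (hev _ j hj hp')
    · obtain ⟨k, rfl⟩ : ∃ k, j = 2 * k := ⟨j / 2, by omega⟩
      rw [hqeven k (by omega), hqodd i hp] at h
      exact absurd h.symm (hev _ i hi hp)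
    · rw [hqodd i hp, hqodd j hp'] at h
      exact hinj i hi j hj hp hp' h
  have hmem : ∀ z, z ∈ Q ↔ ∃ i < 2 * n, q i = z := by
    refine fun z => ⟨fun hz => ?_, ?_⟩
    · by_cases hzV : z ∈ V
      · obtain ⟨k, hk, rfl⟩ := Finset.mem_image.1 hzV
        have := Finset.mem_range.1 hk
        exact ⟨2 * k + 1, by omega, hqodd _ (by omega)⟩
      · let i := σ.symm (e.symm ⟨z, Finset.mem_sdiff.2 ⟨hz, hzV⟩⟩)
        refine ⟨2 * (i : ℕ), by omega, ?_⟩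
        rw [hqeven i i.2]
        simp [i]
    · rintro ⟨i, hi, rfl⟩
      exact hqQ i hi
  have hframed : IsFramed s n q := by
    intro k hk j hj h1 h2
    have hlt := sideStart_lt hn hk
    have hsd := sideStart_odd hn k
    have h3 : q j ≠ q (sideStart n k) := fun h => h1 (hqinj j hj _ hlt h)
    have h4 : q j ≠ q (2 * k + 1) := fun h => h2 (hqinj j hj _ (by omega) h)
    rw [hqodd _ hsd] at h3 ⊢
    rw [hqodd (2 * k + 1) (by omega)] at h4 ⊢
    exact hpos k hk _ (hqQ j hj) h3 h4
  have hgen : LabelsGeneric s n q := fun a ha b hb c hc hab hbc hca =>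
    hQ.orient_ne_zero hs (hqQ a ha) (hqQ b hb) (hqQ c hc) (fun h => hab (hqinj a ha b hb h))
      (fun h => hbc (hqinj b hb c hc h)) (fun h => hca (hqinj c hc a ha h))
  obtain ⟨S, hS, hSpos⟩ := exists_chainTri_of_matching hs hn hframed hgen fun i hi b hb hib => by
    rw [hqodd _ (sideStart_odd hn i), hqodd _ (sideStart_odd hn b), hqodd (2 * i + 1) (by omega),
      hqodd (2 * b + 1) (by omega), hqeven i hi, hqeven b hb]
    exact hσ ⟨i, hi⟩ ⟨b, hb⟩ (by simpa using hib)
  exact ⟨s, q, S, ⟨hn, hframed, hgen, hS, hSpos⟩, hmem, hqodd⟩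

/-- In a double circle every triangulation of the polygon is positively oriented if it contains no
triangle on a side and its inner point, and a positively oriented triangulation of another point
set has this property. -/
theorem PosTri.transfer {S : Multiset (ℕ × ℕ × ℕ)} (h : PosTri s n q S) {p : ℕ → ℂ}
    (hp : DoubleCircleLabels n p) : PosTri 1 n p S := by
  have hn := hp.three_le
  refine ⟨hn, hp.framed, hp.generic, h.tri, fun t ht => ?_⟩
  obtain ⟨a, b, c⟩ := t
  have hb := h.tri.bounds _ _ _ ht
  have hpos := h.pos _ ht
  refine hp.pos a b c hb.2.1 hb.2.2.1 (by omega) ?_ ?_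
  · rintro ⟨h1, rfl, rfl⟩
    obtain ⟨k, rfl⟩ : ∃ k, a = 2 * k + 1 := ⟨a / 2, by omega⟩
    have := h.framed (k + 1) (by omega) (2 * (k + 1)) (by omega)
      (by have := sideStart_odd hn (k + 1); omega) (by omega)
    rw [sideStart_succ, orient_swap_right] at this
    simp only [triOrient] at hpos
    rw [show 2 * (k + 1) = 2 * k + 1 + 1 by ring, show 2 * k + 1 + 1 + 1 = 2 * k + 1 + 2 by ring]
      at this
    linarith
  · rintro ⟨rfl, rfl, rfl⟩
    have := h.framed 0 (by omega) 0 (by omega) (by rw [sideStart_zero]; omega) (by omega)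
    rw [sideStart_zero, orient_swap_right, ← orient_rot, ← orient_rot] at this
    simp only [triOrient] at hpos
    simp only [mul_zero, zero_add] at this
    rw [orient_rot] at this
    linarith

theorem PosTri.mk_mem_faceEdges_iff {S : Multiset (ℕ × ℕ × ℕ)} (h : PosTri s n q S) {i j : ℕ}
    (hi : i < 2 * n) (hj : j < 2 * n) : s(q i, q j) ∈ faceEdges q (S + pockets n) ↔
      ∃ t ∈ S + pockets n, HasEdge t i j ∨ HasEdge t j i := by
  constructor
  · rintro ⟨t, ht, x, y, he, hxy⟩
    obtain ⟨hx, hy, -⟩ := h.hasEdge_spec ht he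
    have hinj := fun {a b : ℕ} (ha : a < 2 * n) (hb : b < 2 * n) =>
      h.generic.injOn h.three_le ha hb
    rcases Sym2.eq_iff.1 hxy with ⟨h1, h2⟩ | ⟨h1, h2⟩
    · obtain rfl := hinj hi hx h1
      obtain rfl := hinj hj hy h2
      exact ⟨t, ht, Or.inl he⟩
    · obtain rfl := hinj hi hy h1
      obtain rfl := hinj hj hx h2
      exact ⟨t, ht, Or.inr he⟩
  · rintro ⟨t, ht, he | he⟩
    · exact ⟨t, ht, i, j, he, rfl⟩
    · exact ⟨t, ht, j, i, he, Sym2.eq_swap⟩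

end DoubleCircle

end

open DoubleCircle in
theorem mainTheorem2 (P : Finset ℂ) (hP : DoubleCircle.IsDoubleCircle P) :
    DoubleCircle.IsUniversal P := by
  obtain ⟨n, p, hp, hPmem⟩ := hP.exists_labels
  have hn := hp.three_le
  have hpinj : ∀ {i j : ℕ}, i < 2 * n → j < 2 * n → p i = p j → i = j := fun hi hj =>
    hp.generic.injOn hn hi hj
  intro Q hQ hcard f₀ hf₀
  have hPcard : P.card = 2 * n := by
    have : P = (Finset.range (2 * n)).image p := by
      ext z
      simp [hPmem]
    rw [this, Finset.card_image_of_injOn, Finset.card_range]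
    intro i hi j hj hij
    exact hpinj (by simpa using hi) (by simpa using hj) hij
  have hvert : ∀ i < 2 * n, i % 2 = 1 → p i ∈ hullVertices P := fun i hi hodd =>
    (hp.mem_hullVertices_iff hPmem).2 ⟨i, hi, hodd, rfl⟩
  obtain ⟨s, q, S, hS, hQmem, hqv⟩ := exists_posTri hn hQ (hcard ▸ hPcard)
    (v := fun i => f₀ (p i))
    (fun i hi hodd => extremePoints_convexHull_subset (hf₀.1.mapsTo (hvert i hi hodd)))
    (fun i hi j hj hi' hj' h =>
      hpinj hi hj (hf₀.1.injOn (hvert i hi hi') (hvert j hj hj') h))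
    (fun k hk => (hf₀.2 _ (hvert _ (sideStart_lt hn hk) (sideStart_odd hn k)) _
      (hvert _ (by omega) (by omega))).1 (hp.framed.isHullEdge hn hp.generic hPmem hk))
  have hTP := hS.transfer hp
  have hex : ∀ z, ∃ y, ∀ i < 2 * n, p i = z → q i = y := by
    intro z
    by_cases hz : ∃ i < 2 * n, p i = z
    · obtain ⟨i, hi, rfl⟩ := hz
      exact ⟨q i, fun j hj h => by rw [hpinj hj hi h]⟩
    · exact ⟨0, fun i hi h => absurd ⟨i, hi, h⟩ hz⟩
  choose f hf using hex
  have hfp : ∀ i < 2 * n, f (p i) = q i := fun i hi => (hf _ i hi rfl).symm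
  refine ⟨f, ⟨?_, ?_, ?_⟩, ?_, faceEdges p (S + pockets n), faceEdges q (S + pockets n),
    hTP.isTriangulation hPmem, hS.isTriangulation hQmem, ?_⟩
  · intro z hz
    obtain ⟨i, hi, rfl⟩ := (hPmem z).1 hz
    rw [hfp i hi]
    exact (hQmem _).2 ⟨i, hi, rfl⟩
  · intro z hz z' hz' h
    obtain ⟨i, hi, rfl⟩ := (hPmem z).1 hz
    obtain ⟨j, hj, rfl⟩ := (hPmem z').1 hz'
    rw [hfp i hi, hfp j hj] at h
    rw [hS.generic.injOn hn hi hj h]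
  · intro z hz
    obtain ⟨i, hi, rfl⟩ := (hQmem z).1 hz
    exact ⟨p i, (hPmem _).2 ⟨i, hi, rfl⟩, hfp i hi⟩
  · intro z hz
    obtain ⟨i, hi, hodd, rfl⟩ := (hp.mem_hullVertices_iff hPmem).1 hz
    rw [hfp i hi, hqv i hodd]
  · intro z hz z' hz'
    obtain ⟨i, hi, rfl⟩ := (hPmem z).1 hz
    obtain ⟨j, hj, rfl⟩ := (hPmem z').1 hz'
    rw [hfp i hi, hfp j hj, hTP.mk_mem_faceEdges_iff hi hj, hS.mk_mem_faceEdges_iff hi hj]
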